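/- Let $n \ge 1$ be an integer and let $\mathcal{C}$ be an additive and idempotent complete category. A right (resp. left) $\mathcal{C}$-module is a contravariant (resp. covariant) additive functor from $\mathcal{C}$ to abelian groups; exactness of sequences of modules is meant objectwise. A right module $F$ is finitely presented if there is an exact sequence $\mathcal{C}(-,X)\xrightarrow{\mathcal{C}(-,f)}\mathcal{C}(-,Y)\to F\to 0$ for some morphism $f:X\to Y$ in $\mathcal{C}$; a left module $G$ is finitely presented if there is an exact sequence $\mathcal{C}(Y,-)\xrightarrow{\mathcal{C}(f,-)}\mathcal{C}(X,-)\to G\to 0$ for some $f:X\to Y$. Let $\operatorname{mod}\mathcal{C}$ and $\operatorname{mod}\mathcal{C}^{\mathrm{op}}$ be the categories of finitely presented right and left modules. $\mathcal{C}$ is right (resp. left) coherent if $\operatorname{mod}\mathcal{C}$ (resp. $\operatorname{mod}\mathcal{C}^{\mathrm{op}}$) is abelian. An $n$-kernel of $f:X\to Y$ is a sequence $X_n\to\cdots\to X_1\to X$ in $\mathcal{C}$ such that $0\to\mathcal{C}(-,X_n)\to\cdots\to\mathcal{C}(-,X_1)\to\mathcal{C}(-,X)\to\mathcal{C}(-,Y)$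 is exact; an $n$-cokernel of $f$ is a sequence $Y\to Y_1\to\cdots\to Y_n$ such that $0\to\mathcal{C}(Y_n,-)\to\cdots\to\mathcal{C}(Y_1,-)\to\mathcal{C}(Y,-)\to\mathcal{C}(X,-)$ is exact. $\mathcal{C}$ is $n$-abelian if every morphism has an $n$-kernel and an $n$-cokernel; for every monomorphism $f:X\to Y$ and every $n$-cokernel $Y\xrightarrow{g_1}Y_1\to\cdots\xrightarrow{g_n}Y_n$ of $f$, the sequence $X\xrightarrow{f}Y\xrightarrow{g_1}\cdots\xrightarrow{g_{n-1}}Y_{n-1}$ is an $n$-kernel of $g_n$; and for every epimorphism $f:X\to Y$ and every $n$-kernel $X_n\xrightarrow{f_n}\cdots\xrightarrow{f_1}X$ of $f$, the sequence $X_{n-1}\xrightarrow{f_{n-1}}\cdots\xrightarrow{f_1}X\xrightarrow{f}Y$ is an $n$-cokernel of $f_n$ (with $X_0=X$, $Y_0=Y$). For a finitely presented module $F$ with $F\simeq\operatorname{Coker}\mathcal{C}(-,f)$ (resp. $F\simeq\operatorname{Coker}\mathcal{C}(f,-)$), a transpose $\operatorname{Tr}F$ is $\operatorname{Coker}\mathcal{C}(f,-)$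 (resp. $\operatorname{Coker}\mathcal{C}(-,f)$); it is unique up to projective direct summands. If $\mathcal{C}$ is left coherent, $F\in\operatorname{mod}\mathcal{C}$ is $n$-torsion free if $\operatorname{Ext}^i(\operatorname{Tr}F,\mathcal{C}(X,-))=0$ in $\operatorname{mod}\mathcal{C}^{\mathrm{op}}$ for all $X\in\mathcal{C}$ and $1\le i\le n$. If $\mathcal{C}$ is right coherent, $F\in\operatorname{mod}\mathcal{C}^{\mathrm{op}}$ is $n$-torsion free if $\operatorname{Ext}^i(\operatorname{Tr}F,\mathcal{C}(-,X))=0$ in $\operatorname{mod}\mathcal{C}$ for all $X\in\mathcal{C}$ and $1\le i\le n$. Theorem. $\mathcal{C}$ is $n$-abelian if and only if the following four axioms hold: (F1) $\mathcal{C}$ is right coherent and $\operatorname{gl.dim}(\operatorname{mod}\mathcal{C})\le n+1$; (F1$^{\mathrm{op}}$) $\mathcal{C}$ is left coherent and $\operatorname{gl.dim}(\operatorname{mod}\mathcal{C}^{\mathrm{op}})\le n+1$; (F2) every $F\in\operatorname{mod}\mathcal{C}$ with projective dimension $\le 1$ is $n$-torsion free; (F2$^{\mathrm{op}}$) every $F\in\operatorname{mod}\mathcal{C}^{\mathrm{op}}$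 with projective dimension $\le 1$ is $n$-torsion free. -/

import Mathlib

open CategoryTheory CategoryTheory.Limits Opposite

universe v u

noncomputable section

namespace NAb

/-! ### Abelian categories as a property of preadditive categories, and global dimension -/

/-- The property of a category with a given preadditive structure of being abelian. -/
class IsAbelianCategory (A : Type u) [Category.{v} A] [Preadditive A] : Prop where
  hasFiniteProducts : HasFiniteProducts A
  hasKernels : HasKernels A
  hasCokernels : HasCokernels A
  isNormalMonoCategory : IsNormalMonoCategory A
  isNormalEpiCategory : IsNormalEpiCategory A

/-- The abelian structure, over the given preadditive structure. -/
abbrev IsAbelianCategory.abelian (A : Type u) [Category.{v} A] [P : Preadditive A]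
    [h : IsAbelianCategory A] : Abelian A :=
  { P with
    toIsNormalMonoCategory := h.isNormalMonoCategory
    toIsNormalEpiCategory := h.isNormalEpiCategory
    has_finite_products := h.hasFiniteProducts
    has_kernels := h.hasKernels
    has_cokernels := h.hasCokernels }

/-- The global dimension of an abelian category: the supremum of the projective dimensions of
its objects. -/
def globalDimension (A : Type u) [Category.{v} A] [Abelian A] : WithBot ℕ∞ :=
  ⨆ X : A, projectiveDimension X

section Modules

variable {C : Type u} [Category.{v} C] [Preadditive C]

/-! ### Finitely presented modules

A right module is an additive functor `Cᵒᵖ ⥤ AddCommGrpCat`, a left module is an additive functor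
`C ⥤ AddCommGrpCat`. Exactness of sequences of modules is exactness at each object. -/

/-- There is an exact sequence `C(-, X) ⟶ C(-, Y) ⟶ F ⟶ 0` whose first map is `C(-, f)`;
in other words `F` is a cokernel of `C(-, f)`. -/
def RightPresents {X Y : C} (f : X ⟶ Y) (F : Cᵒᵖ ⥤ AddCommGrpCat.{v}) : Prop :=
  ∃ p : preadditiveYoneda.obj Y ⟶ F, ∀ Z : Cᵒᵖ,
    Function.Exact ((preadditiveYoneda.map f).app Z).hom (p.app Z).hom ∧
      Function.Surjective (p.app Z).hom

/-- There is an exact sequence `C(Y, -) ⟶ C(X, -) ⟶ F ⟶ 0` whose first map is `C(f, -)`;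
in other words `F` is a cokernel of `C(f, -)`. -/
def LeftPresents {X Y : C} (f : X ⟶ Y) (F : C ⥤ AddCommGrpCat.{v}) : Prop :=
  ∃ p : preadditiveCoyoneda.obj (op X) ⟶ F, ∀ Z : C,
    Function.Exact ((preadditiveCoyoneda.map f.op).app Z).hom (p.app Z).hom ∧
      Function.Surjective (p.app Z).hom

variable (C) in
/-- Finitely presented right modules. -/
def isFpRight : ObjectProperty (Cᵒᵖ ⥤ AddCommGrpCat.{v}) := fun F =>
  F.Additive ∧ ∃ (X Y : C) (f : X ⟶ Y), RightPresents f F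

variable (C) in
/-- Finitely presented left modules. -/
def isFpLeft : ObjectProperty (C ⥤ AddCommGrpCat.{v}) := fun F =>
  F.Additive ∧ ∃ (X Y : C) (f : X ⟶ Y), LeftPresents f F

variable (C) in
/-- The category of finitely presented right `C`-modules. -/
abbrev FpRight := (isFpRight C).FullSubcategory

variable (C) in
/-- The category of finitely presented left `C`-modules. -/
abbrev FpLeft := (isFpLeft C).FullSubcategory

lemma isFpRight_yoneda (X : C) : isFpRight C (preadditiveYoneda.obj X) := by
  refine ⟨inferInstance, X, X, 0, 𝟙 _, fun Z => ⟨fun a => ?_, fun a => ⟨a, rfl⟩⟩⟩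
  constructor
  · rintro (rfl : a = 0)
    exact ⟨0, map_zero _⟩
  · rintro ⟨b, rfl⟩
    exact (comp_zero : (show Z.unop ⟶ X from b) ≫ (0 : X ⟶ X) = 0)

lemma isFpLeft_coyoneda (X : C) : isFpLeft C (preadditiveCoyoneda.obj (op X)) := by
  refine ⟨inferInstance, X, X, 0, 𝟙 _, fun Z => ⟨fun a => ?_, fun a => ⟨a, rfl⟩⟩⟩
  constructor
  · rintro (rfl : a = 0)
    exact ⟨0, map_zero _⟩
  · rintro ⟨b, rfl⟩
    exact (zero_comp : (0 : X ⟶ X) ≫ (show X ⟶ Z from b) = 0)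

/-- The representable right module `C(-, X)`. -/
def rightRep (X : C) : FpRight C := ⟨preadditiveYoneda.obj X, isFpRight_yoneda X⟩

/-- The representable left module `C(X, -)`. -/
def leftRep (X : C) : FpLeft C := ⟨preadditiveCoyoneda.obj (op X), isFpLeft_coyoneda X⟩

/-! ### Coherence -/

variable (C) in
/-- `C` is right coherent: the category of finitely presented right modules is abelian. -/
abbrev IsRightCoherent : Prop := IsAbelianCategory (FpRight C)

variable (C) in
/-- `C` is left coherent: the category of finitely presented left modules is abelian. -/
abbrev IsLeftCoherent : Prop := IsAbelianCategory (FpLeft C)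

instance abelianFpRight [IsRightCoherent C] : Abelian (FpRight C) :=
  IsAbelianCategory.abelian (FpRight C)

instance abelianFpLeft [IsLeftCoherent C] : Abelian (FpLeft C) :=
  IsAbelianCategory.abelian (FpLeft C)

/-! ### Transposes and torsion free modules -/

/-- The left module `T` is a transpose of the right module `F`, or, equivalently, `F` is a
transpose of `T`: some morphism `f` of `C` satisfies `F ≅ Coker C(-, f)` and
`T ≅ Coker C(f, -)`. -/
def AreTransposes (F : FpRight C) (T : FpLeft C) : Prop :=
  ∃ (X Y : C) (f : X ⟶ Y), RightPresents f F.obj ∧ LeftPresents f T.obj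

/-- The finitely presented right module `F` is `k`-torsion free: `Ext^i(Tr F, C(X, -)) = 0` for
all `1 ≤ i ≤ k` and all `X`, with `Ext` taken in the category of finitely presented left modules.
As transposes are unique only up to projective summands, all of them are considered. -/
def IsRightTorsionFree [IsLeftCoherent C] (k : ℕ) (F : FpRight C) : Prop :=
  letI := HasExt.standard (FpLeft C)
  ∀ T : FpLeft C, AreTransposes F T → ∀ i : ℕ, 1 ≤ i → i ≤ k → ∀ X : C,
    Subsingleton (Abelian.Ext T (leftRep X) i)

/-- The finitely presented left module `F` is `k`-torsion free: `Ext^i(Tr F, C(-, X)) = 0` for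
all `1 ≤ i ≤ k` and all `X`, with `Ext` taken in the category of finitely presented right
modules. -/
def IsLeftTorsionFree [IsRightCoherent C] (k : ℕ) (F : FpLeft C) : Prop :=
  letI := HasExt.standard (FpRight C)
  ∀ T : FpRight C, AreTransposes T F → ∀ i : ℕ, 1 ≤ i → i ≤ k → ∀ X : C,
    Subsingleton (Abelian.Ext T (rightRep X) i)

/-! ### `n`-kernels, `n`-cokernels and `n`-abelian categories

A sequence `Z : ComposableArrows C (n + 1)` is `Z 0 ⟶ Z 1 ⟶ ⋯ ⟶ Z n ⟶ Z (n + 1)`. -/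

/-- The first `n` morphisms `Z 0 ⟶ ⋯ ⟶ Z n` form an `n`-kernel of the last morphism
`Z n ⟶ Z (n + 1)`: the sequence `0 ⟶ C(-, Z 0) ⟶ ⋯ ⟶ C(-, Z n) ⟶ C(-, Z (n + 1))` is exact. -/
structure InitIsNKernelOfLast {n : ℕ} (Z : ComposableArrows C (n + 1)) : Prop where
  injective (W : C) : Function.Injective fun a : W ⟶ Z.obj' 0 => a ≫ Z.map' 0 1
  exact (i : ℕ) (hi : i < n) (W : C) :
    Function.Exact (fun a : W ⟶ Z.obj' i => a ≫ Z.map' i (i + 1))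
      (fun b : W ⟶ Z.obj' (i + 1) => b ≫ Z.map' (i + 1) (i + 2))

/-- The last `n` morphisms `Z 1 ⟶ ⋯ ⟶ Z (n + 1)` form an `n`-cokernel of the first morphism
`Z 0 ⟶ Z 1`: the sequence `0 ⟶ C(Z (n + 1), -) ⟶ ⋯ ⟶ C(Z 1, -) ⟶ C(Z 0, -)` is exact. -/
structure TailIsNCokernelOfFirst {n : ℕ} (Z : ComposableArrows C (n + 1)) : Prop where
  injective (W : C) : Function.Injective fun a : Z.obj' (n + 1) ⟶ W => Z.map' n (n + 1) ≫ a
  exact (i : ℕ) (hi : i < n) (W : C) :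
    Function.Exact (fun a : Z.obj' (i + 2) ⟶ W => Z.map' (i + 1) (i + 2) ≫ a)
      (fun b : Z.obj' (i + 1) ⟶ W => Z.map' i (i + 1) ≫ b)

variable (C) in
/-- Every morphism has an `n`-kernel. (The last morphism of `Z` is `f` up to an isomorphism of
arrows, along which the ends of `Z` can be replaced.) -/
def HasNKernels (n : ℕ) : Prop :=
  ∀ ⦃X Y : C⦄ (f : X ⟶ Y), ∃ Z : ComposableArrows C (n + 1),
    Nonempty (Arrow.mk (Z.map' n (n + 1)) ≅ Arrow.mk f) ∧ InitIsNKernelOfLast Z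

variable (C) in
/-- Every morphism has an `n`-cokernel. -/
def HasNCokernels (n : ℕ) : Prop :=
  ∀ ⦃X Y : C⦄ (f : X ⟶ Y), ∃ Z : ComposableArrows C (n + 1),
    Nonempty (Arrow.mk (Z.map' 0 1) ≅ Arrow.mk f) ∧ TailIsNCokernelOfFirst Z

variable (C) in
/-- The axioms of an `n`-abelian category, for an additive idempotent complete category `C`. -/
structure IsNAbelian (n : ℕ) : Prop where
  hasNKernels : HasNKernels C n
  hasNCokernels : HasNCokernels C n
  /-- For a monomorphism `Z 0 ⟶ Z 1` with an `n`-cokernel `Z 1 ⟶ ⋯ ⟶ Z (n + 1)`, the sequence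
  `Z 0 ⟶ ⋯ ⟶ Z n` is an `n`-kernel of `Z n ⟶ Z (n + 1)`. -/
  mono (Z : ComposableArrows C (n + 1)) (hZ : Mono (Z.map' 0 1))
    (h : TailIsNCokernelOfFirst Z) : InitIsNKernelOfLast Z
  /-- For an epimorphism `Z n ⟶ Z (n + 1)` with an `n`-kernel `Z 0 ⟶ ⋯ ⟶ Z n`, the sequence
  `Z 1 ⟶ ⋯ ⟶ Z (n + 1)` is an `n`-cokernel of `Z 0 ⟶ Z 1`. -/
  epi (Z : ComposableArrows C (n + 1)) (hZ : Epi (Z.map' n (n + 1)))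
    (h : InitIsNKernelOfLast Z) : TailIsNCokernelOfFirst Z

end Modules

end NAb

end

set_option linter.unusedSectionVars false

namespace NAb

/-! ### Categories of finitely presented objects

A category `A` of finitely presented modules over `D` is used through the functor `h : D ⥤ A` that
sends an object to the representable module. -/

section Presentation

universe v₁ u₁ v₂ u₂

variable {D : Type u₁} [Category.{v₁} D] [Preadditive D]
  {A : Type u₂} [Category.{v₂} A] [Preadditive A]

/-! Left modules over `C` are right modules over `Cᵒᵖ`, so most of the argument is carried out once,
for a functor `h : D ⥤ A` exhibiting `A` as the finitely presented `D`-modules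
(`IsPresentationFunctor`), and used with `D = C` and `D = Cᵒᵖ`.

(F1) amounts to the existence of `n`-kernels, and (F1op) to that of `n`-cokernels. If `f` presents
`F` and `k` is a weak kernel of `f`, then `k` presents the first syzygy of `F`
(`Presents.exists_shortExact`). Hence weak kernels in `D` make `A` abelian
(`isAbelianCategory_of_rep`), and an `n`-kernel of `f` is a projective resolution of `F` of length
`n + 1`. Conversely, idempotent completeness makes every projective representable, so a bound on the
projective dimension stops the iteration of weak kernels at a monomorphism
(`forall_hasProjectiveDimensionLE_iff`).

(F2) and (F2op) amount to the axioms on monomorphisms and epimorphisms. An `n`-cokernel of `g`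
resolves `Coker C(g, -)`; mapping this resolution to representables gives back the same sequence
seen by right modules, so vanishing of each Ext group is exactness at one spot
(`TailIsNCokernelOfFirst.subsingleton_ext_iff` and its dual). If `g` is mono, `Coker C(-, g)` has
projective dimension at most 1. Conversely, any presentation of such a module is a split epimorphism
followed by a monomorphism (`Presents.exists_retraction_comp_mono`), and the split part does not
affect the Ext groups of the transpose (`Presents.subsingleton_ext_comp`). -/

/-- `h X ⟶ h Y ⟶ F ⟶ 0` becomes exact after applying `Hom(h Z, -)` for all `Z`. -/
structure Presents (h : D ⥤ A) {X Y : D} (f : X ⟶ Y) {F : A} (p : h.obj Y ⟶ F) : Prop where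
  zero : h.map f ≫ p = 0
  exact {Z : D} (a : Z ⟶ Y) : h.map a ≫ p = 0 → ∃ b : Z ⟶ X, b ≫ f = a
  surj {Z : D} (x : h.obj Z ⟶ F) : ∃ a : Z ⟶ Y, h.map a ≫ p = x

/-- A fully faithful additive functor `h : D ⥤ A` identifying `A` with the category of finitely
presented `D`-modules. -/
class IsPresentationFunctor (h : D ⥤ A) : Prop where
  full : h.Full
  faithful : h.Faithful
  additive : h.Additive
  exists_presentation (F : A) : ∃ (X Y : D) (f : X ⟶ Y) (p : h.obj Y ⟶ F), Presents h f p
  exists_presented {X Y : D} (f : X ⟶ Y) : ∃ (F : A) (p : h.obj Y ⟶ F), Presents h f p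
  epi {X Y : D} {f : X ⟶ Y} {F : A} {p : h.obj Y ⟶ F} : Presents h f p → Epi p
  desc {X Y : D} {f : X ⟶ Y} {F : A} {p : h.obj Y ⟶ F} : Presents h f p →
    ∀ {G : A} (q : h.obj Y ⟶ G), h.map f ≫ q = 0 → ∃ r : F ⟶ G, p ≫ r = q

attribute [instance] IsPresentationFunctor.full IsPresentationFunctor.faithful
  IsPresentationFunctor.additive

/-- `k` is a weak kernel of `f`. -/
structure IsWeakKernel {K X Y : D} (k : K ⟶ X) (f : X ⟶ Y) : Prop where
  zero : k ≫ f = 0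
  lift {Z : D} (a : Z ⟶ X) : a ≫ f = 0 → ∃ b : Z ⟶ K, b ≫ k = a

variable (D) in
/-- Every morphism has a weak kernel. -/
def HasWeakKernels : Prop :=
  ∀ ⦃X Y : D⦄ (f : X ⟶ Y), ∃ (K : D) (k : K ⟶ X), IsWeakKernel k f

/-- Every morphism from an object `h Z` that is killed by `m` is zero. -/
def RepInjective (h : D ⥤ A) {F G : A} (m : F ⟶ G) : Prop :=
  ∀ ⦃Z : D⦄ (x : h.obj Z ⟶ F), x ≫ m = 0 → x = 0

/-- Every morphism from an object `h Z` lifts along `e`. -/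
def RepSurjective (h : D ⥤ A) {F G : A} (e : F ⟶ G) : Prop :=
  ∀ ⦃Z : D⦄ (x : h.obj Z ⟶ G), ∃ y : h.obj Z ⟶ F, y ≫ e = x

/-- The sequence given by `u` and `w` becomes exact after applying `Hom(h Z, -)` for all `Z`. -/
structure RepExact (h : D ⥤ A) {F G H : A} (u : F ⟶ G) (w : G ⟶ H) : Prop where
  zero : u ≫ w = 0
  lift ⦃Z : D⦄ (x : h.obj Z ⟶ G) : x ≫ w = 0 → ∃ y : h.obj Z ⟶ F, y ≫ u = x

variable {h : D ⥤ A} [IsPresentationFunctor h]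

lemma Presents.epi {X Y : D} {f : X ⟶ Y} {F : A} {p : h.obj Y ⟶ F} (hp : Presents h f p) :
    Epi p := IsPresentationFunctor.epi hp

lemma Presents.desc {X Y : D} {f : X ⟶ Y} {F : A} {p : h.obj Y ⟶ F} (hp : Presents h f p)
    {G : A} (q : h.obj Y ⟶ G) (hq : h.map f ≫ q = 0) : ∃ r : F ⟶ G, p ≫ r = q :=
  IsPresentationFunctor.desc hp q hq

lemma Presents.hom_ext {X Y : D} {f : X ⟶ Y} {F : A} {p : h.obj Y ⟶ F} (hp : Presents h f p)
    {G : A} {a b : F ⟶ G} (hab : p ≫ a = p ≫ b) : a = b := by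
  have := hp.epi
  exact (cancel_epi p).1 hab

variable (h) in
lemma rep_hom_ext {F G : A} {a b : F ⟶ G}
    (hab : ∀ ⦃Z : D⦄ (x : h.obj Z ⟶ F), x ≫ a = x ≫ b) : a = b := by
  obtain ⟨X, Y, f, p, hp⟩ := IsPresentationFunctor.exists_presentation (h := h) F
  exact hp.hom_ext (hab p)

lemma RepInjective.mono {F G : A} {m : F ⟶ G} (hm : RepInjective h m) : Mono m := by
  refine Preadditive.mono_of_cancel_zero _ fun {T} g hg => rep_hom_ext h fun Z x => ?_
  rw [comp_zero]
  exact hm _ (by rw [Category.assoc, hg, comp_zero])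

lemma RepExact.exists_lift {F G H : A} {u : F ⟶ G} {w : G ⟶ H} (hu : RepInjective h u)
    (huw : RepExact h u w) {T : A} (t : T ⟶ G) (ht : t ≫ w = 0) : ∃ l : T ⟶ F, l ≫ u = t := by
  obtain ⟨X, Y, f, p, hp⟩ := IsPresentationFunctor.exists_presentation (h := h) T
  obtain ⟨l, hl⟩ := huw.lift (p ≫ t) (by rw [Category.assoc, ht, comp_zero])
  obtain ⟨r, hr⟩ := hp.desc l (hu _ (by
    rw [Category.assoc, hl, reassoc_of% hp.zero, zero_comp]))
  exact ⟨r, hp.hom_ext (by rw [reassoc_of% hr, hl])⟩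

/-- An objectwise injective map with objectwise the right image is a kernel. -/
noncomputable def RepExact.isLimit {F G H : A} {u : F ⟶ G} {w : G ⟶ H} (hu : RepInjective h u)
    (huw : RepExact h u w) : IsLimit (KernelFork.ofι u huw.zero) :=
  have := hu.mono
  KernelFork.IsLimit.ofι _ _ (fun t ht => (huw.exists_lift hu t ht).choose)
    (fun t ht => (huw.exists_lift hu t ht).choose_spec)
    (fun t ht _ hm => (cancel_mono u).1
      (hm.trans (huw.exists_lift hu t ht).choose_spec.symm))

lemma RepSurjective.epi {F G : A} {e : F ⟶ G} (he : RepSurjective h e) : Epi e := by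
  refine Preadditive.epi_of_cancel_zero _ fun {T} g hg => rep_hom_ext h fun Z x => ?_
  obtain ⟨y, rfl⟩ := he x
  rw [Category.assoc, hg, comp_zero, comp_zero]

/-- Lift the generators of `H` along `w` and apply `t`. Two lifts differ by something in the image
of `u`, which `t` kills, so the choice of lift is harmless. -/
lemma RepExact.exists_desc {F G H : A} {u : F ⟶ G} {w : G ⟶ H} (hw : RepSurjective h w)
    (huw : RepExact h u w) {T : A} (t : G ⟶ T) (ht : u ≫ t = 0) : ∃ l : H ⟶ T, w ≫ l = t := by
  obtain ⟨X, Y, f, p, hp⟩ := IsPresentationFunctor.exists_presentation (h := h) H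
  obtain ⟨c, hc⟩ := hw p
  have key : ∀ ⦃Z : D⦄ (x : h.obj Z ⟶ G), x ≫ w = 0 → x ≫ t = 0 := by
    intro Z x hx
    obtain ⟨y, rfl⟩ := huw.lift x hx
    rw [Category.assoc, ht, comp_zero]
  obtain ⟨r, hr⟩ := hp.desc (c ≫ t) (by
    rw [← Category.assoc]
    exact key _ (by rw [Category.assoc, hc, hp.zero]))
  refine ⟨r, rep_hom_ext h fun Z x => ?_⟩
  obtain ⟨a, ha⟩ := hp.surj (x ≫ w)
  have := key (x - h.map a ≫ c) (by rw [Preadditive.sub_comp, Category.assoc, hc, ha, sub_self])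
  rw [Preadditive.sub_comp, sub_eq_zero, Category.assoc] at this
  rw [this, ← reassoc_of% ha, hr]

/-- An objectwise surjective map with objectwise the right kernel is a cokernel. -/
noncomputable def RepExact.isColimit {F G H : A} {u : F ⟶ G} {w : G ⟶ H}
    (hw : RepSurjective h w) (huw : RepExact h u w) :
    IsColimit (CokernelCofork.ofπ w huw.zero) :=
  have := hw.epi
  CokernelCofork.IsColimit.ofπ _ _ (fun t ht => (huw.exists_desc hw t ht).choose)
    (fun t ht => (huw.exists_desc hw t ht).choose_spec)
    (fun t ht _ hm => (cancel_epi w).1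
      (hm.trans (huw.exists_desc hw t ht).choose_spec.symm))

lemma Presents.repExact {X Y : D} {f : X ⟶ Y} {F : A} {p : h.obj Y ⟶ F} (hp : Presents h f p) :
    RepExact h (h.map f) p where
  zero := hp.zero
  lift Z x hx := by
    obtain ⟨a, rfl⟩ := h.map_surjective x
    obtain ⟨b, rfl⟩ := hp.exact a hx
    exact ⟨h.map b, by rw [h.map_comp]⟩

/-! ### Cokernels, and projectivity of representables -/

section Cokernels

variable [HasBinaryBiproducts D]

variable (h) in
lemma exists_repCokernel {F G : A} (φ : F ⟶ G) :
    ∃ (H : A) (π : G ⟶ H), RepExact h φ π ∧ RepSurjective h π := by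
  obtain ⟨X', Y', f, p, hp⟩ := IsPresentationFunctor.exists_presentation (h := h) F
  obtain ⟨X, Y, g, q, hq⟩ := IsPresentationFunctor.exists_presentation (h := h) G
  obtain ⟨a, ha⟩ := hq.surj (p ≫ φ)
  -- The cokernel has the generators of `G`, with the relations `g` of `G` and the images `a` of the
  -- generators of `F`.
  obtain ⟨H, r, hr⟩ := IsPresentationFunctor.exists_presented (h := h) (biprod.desc g a)
  have hgr : h.map g ≫ r = 0 := by
    have : g = biprod.inl ≫ biprod.desc g a := by simp
    rw [this, h.map_comp, Category.assoc, hr.zero, comp_zero]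
  have har : h.map a ≫ r = 0 := by
    have : a = biprod.inr ≫ biprod.desc g a := by simp
    rw [this, h.map_comp, Category.assoc, hr.zero, comp_zero]
  obtain ⟨π, hπ⟩ := hq.desc r hgr
  refine ⟨H, π, ⟨hp.hom_ext ?_, fun Z x hx => ?_⟩, fun Z x => ?_⟩
  · rw [comp_zero, ← reassoc_of% ha, hπ, har]
  · obtain ⟨y, rfl⟩ := hq.surj x
    rw [Category.assoc, hπ] at hx
    obtain ⟨b, rfl⟩ := hr.exact y hx
    refine ⟨h.map (b ≫ biprod.snd) ≫ p, ?_⟩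
    have : b ≫ biprod.desc g a = (b ≫ biprod.fst) ≫ g + (b ≫ biprod.snd) ≫ a := by
      rw [biprod.desc_eq]; simp
    rw [this, h.map_add, Preadditive.add_comp, h.map_comp _ g, h.map_comp _ a, Category.assoc,
      Category.assoc, Category.assoc, hq.zero, comp_zero, zero_add, ha]
  · obtain ⟨y, rfl⟩ := hr.surj x
    exact ⟨h.map y ≫ q, by rw [Category.assoc, hπ]⟩

variable (h) in
-- The objectwise cokernel of an epimorphism is zero, so nothing obstructs lifting from
-- representables.
lemma repSurjective_of_epi {F G : A} (e : F ⟶ G) [Epi e] : RepSurjective h e := by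
  obtain ⟨H, π, h₁, h₂⟩ := exists_repCokernel h e
  intro Z x
  have : π = 0 := (cancel_epi e).1 (by rw [h₁.zero, comp_zero])
  exact h₁.lift x (by rw [this, comp_zero])

variable (h) in
lemma projective_rep (X : D) : Projective (h.obj X) where
  factors x e _ := repSurjective_of_epi h e x

end Cokernels

/-! ### Kernels from weak kernels -/

section Kernels

variable [HasBinaryBiproducts D]

variable (h) in
lemma exists_repExact_rep (hD : HasWeakKernels D) {F G : A} (φ : F ⟶ G) :
    ∃ (K : D) (k : h.obj K ⟶ F), RepExact h k φ := by
  obtain ⟨X', Y', f, p, hp⟩ := IsPresentationFunctor.exists_presentation (h := h) F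
  obtain ⟨X, Y, g, q, hq⟩ := IsPresentationFunctor.exists_presentation (h := h) G
  obtain ⟨a, ha⟩ := hq.surj (p ≫ φ)
  -- A weak pullback of `a` and `g`: generators of `F`, paired with a relation witnessing that their
  -- image in `G` is zero.
  obtain ⟨K, k, hk⟩ := hD (biprod.desc a (-g))
  have hk' : (k ≫ biprod.fst) ≫ a = (k ≫ biprod.snd) ≫ g := by
    have := hk.zero
    rw [biprod.desc_eq] at this
    simpa [← sub_eq_add_neg, sub_eq_zero] using this
  refine ⟨K, h.map (k ≫ biprod.fst) ≫ p, ?_, fun Z x hx => ?_⟩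
  · rw [Category.assoc, ← ha, ← h.map_comp_assoc, hk', h.map_comp, Category.assoc, hq.zero,
      comp_zero]
  · obtain ⟨y, rfl⟩ := hp.surj x
    rw [Category.assoc, ← ha, ← h.map_comp_assoc] at hx
    obtain ⟨z, hz⟩ := hq.exact _ hx
    obtain ⟨b, hb⟩ := hk.lift (biprod.lift y z) (by simp [hz])
    refine ⟨h.map b, ?_⟩
    rw [← h.map_comp_assoc, reassoc_of% hb, biprod.lift_fst]

variable (h) in
-- Cover the kernel by a representable, then cover the relations among its generators in the same
-- way; the resulting morphism presents the kernel.
lemma exists_repKernel (hD : HasWeakKernels D) {F G : A} (φ : F ⟶ G) :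
    ∃ (K : A) (ι : K ⟶ F), RepInjective h ι ∧ RepExact h ι φ := by
  obtain ⟨Y, k, hk⟩ := exists_repExact_rep h hD φ
  obtain ⟨X, l, hl⟩ := exists_repExact_rep h hD k
  obtain ⟨l, rfl⟩ := h.map_surjective l
  obtain ⟨K, p, hp⟩ := IsPresentationFunctor.exists_presented (h := h) l
  obtain ⟨ι, hι⟩ := hp.desc k hl.zero
  refine ⟨K, ι, fun Z x hx => ?_, hp.hom_ext ?_, fun Z x hx => ?_⟩
  · obtain ⟨y, rfl⟩ := hp.surj x
    rw [Category.assoc, hι] at hx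
    obtain ⟨z, hz⟩ := hl.lift _ hx
    rw [← hz, Category.assoc, hp.zero, comp_zero]
  · rw [comp_zero, reassoc_of% hι, hk.zero]
  · obtain ⟨y, rfl⟩ := hk.lift x hx
    exact ⟨y ≫ p, by rw [Category.assoc, hι]⟩

end Kernels

/-! ### Weak kernels make the module category abelian -/

lemma hasZeroObject_of_rep (h : D ⥤ A) [IsPresentationFunctor h] [HasZeroObject D] : HasZeroObject A :=
  (HasZeroObject.zero (C := D)).elim fun X hX => ⟨⟨h.obj X, h.map_isZero hX⟩⟩

lemma hasBinaryBiproducts_of_rep (h : D ⥤ A) [IsPresentationFunctor h] [HasBinaryBiproducts D] : HasBinaryBiproducts A where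
  has_binary_biproduct F G := by
    obtain ⟨X', Y', f, p, hp⟩ := IsPresentationFunctor.exists_presentation (h := h) F
    obtain ⟨X, Y, g, q, hq⟩ := IsPresentationFunctor.exists_presentation (h := h) G
    obtain ⟨H, r, hr⟩ := IsPresentationFunctor.exists_presented (h := h) (biprod.map f g)
    obtain ⟨i, hi⟩ := hp.desc (h.map biprod.inl ≫ r) (by
      rw [← h.map_comp_assoc, ← biprod.inl_map f g, h.map_comp, Category.assoc, hr.zero,
        comp_zero])
    obtain ⟨j, hj⟩ := hq.desc (h.map biprod.inr ≫ r) (by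
      rw [← h.map_comp_assoc, ← biprod.inr_map f g, h.map_comp, Category.assoc, hr.zero,
        comp_zero])
    obtain ⟨s, hs⟩ := hr.desc (h.map biprod.fst ≫ p) (by
      rw [← h.map_comp_assoc, biprod.map_fst, h.map_comp, Category.assoc, hp.zero, comp_zero])
    obtain ⟨t, ht⟩ := hr.desc (h.map biprod.snd ≫ q) (by
      rw [← h.map_comp_assoc, biprod.map_snd, h.map_comp, Category.assoc, hq.zero, comp_zero])
    let b : BinaryBicone F G :=
      { pt := H, fst := s, snd := t, inl := i, inr := j
        inl_fst := hp.hom_ext (by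
          rw [reassoc_of% hi, hs, ← h.map_comp_assoc, biprod.inl_fst, h.map_id, Category.id_comp,
            Category.comp_id])
        inl_snd := hp.hom_ext (by
          rw [reassoc_of% hi, ht, ← h.map_comp_assoc, biprod.inl_snd, h.map_zero, zero_comp,
            comp_zero])
        inr_fst := hq.hom_ext (by
          rw [reassoc_of% hj, hs, ← h.map_comp_assoc, biprod.inr_fst, h.map_zero, zero_comp,
            comp_zero])
        inr_snd := hq.hom_ext (by
          rw [reassoc_of% hj, ht, ← h.map_comp_assoc, biprod.inr_snd, h.map_id, Category.id_comp,
            Category.comp_id]) }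
    refine hasBinaryBiproduct_of_total b (hr.hom_ext ?_)
    rw [Category.comp_id, Preadditive.comp_add]
    change r ≫ s ≫ i + r ≫ t ≫ j = r
    rw [reassoc_of% hs, reassoc_of% ht, hi, hj, ← h.map_comp_assoc, ← h.map_comp_assoc,
      ← Preadditive.add_comp, ← h.map_add, biprod.total, h.map_id, Category.id_comp]

lemma isAbelianCategory_of_rep (h : D ⥤ A) [IsPresentationFunctor h] [HasZeroObject D]
    [HasBinaryBiproducts D] (hD : HasWeakKernels D) : IsAbelianCategory A where
  hasFiniteProducts := by
    have := hasZeroObject_of_rep h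
    have := hasBinaryBiproducts_of_rep h
    exact hasFiniteProducts_of_has_binary_and_terminal
  hasKernels := ⟨fun φ => by
    obtain ⟨K, ι, hι, hιφ⟩ := exists_repKernel h hD φ
    exact ⟨⟨_, hιφ.isLimit hι⟩⟩⟩
  hasCokernels := ⟨fun φ => by
    obtain ⟨H, π, hφπ, hπ⟩ := exists_repCokernel h φ
    exact ⟨⟨_, hφπ.isColimit hπ⟩⟩⟩
  isNormalMonoCategory := ⟨fun {F G} m _ => by
    obtain ⟨H, π, hmπ, -⟩ := exists_repCokernel h m
    exact ⟨⟨H, π, hmπ.zero, hmπ.isLimit fun Z x hx => (cancel_mono m).1 (by rw [hx, zero_comp])⟩⟩⟩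
  isNormalEpiCategory := ⟨fun {F G} e _ => by
    obtain ⟨K, ι, -, hιe⟩ := exists_repKernel h hD e
    exact ⟨⟨K, ι, hιe.zero, hιe.isColimit (repSurjective_of_epi h e)⟩⟩⟩

end Presentation

section Abelian

universe w v₁ u₁ v₂ u₂

variable {D : Type u₁} [Category.{v₁} D] [Preadditive D] [HasBinaryBiproducts D]
  {A : Type u₂} [Category.{v₂} A] [Abelian A] {h : D ⥤ A} [IsPresentationFunctor h]

/-! ### Exactness, projectives and syzygies -/

/-- A presentation of the test object is an epimorphism from a representable, so it serves as the
refinement along which to lift. -/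
lemma RepExact.exact {F G H : A} {u : F ⟶ G} {w : G ⟶ H} (huw : RepExact h u w) :
    (ShortComplex.mk u w huw.zero).Exact := by
  rw [ShortComplex.exact_iff_exact_up_to_refinements]
  intro T t ht
  obtain ⟨X, Y, f, p, hp⟩ := IsPresentationFunctor.exists_presentation (h := h) T
  obtain ⟨y, hy⟩ := huw.lift (p ≫ t) (by rw [Category.assoc]; exact ht ▸ comp_zero)
  exact ⟨_, p, hp.epi, y, hy.symm⟩

/-- If `q` is presented by a weak kernel of `f`, it gives the first syzygy of the object presented
by `f`. -/
lemma Presents.exists_shortExact {K X Y : D} {k : K ⟶ X} {f : X ⟶ Y} (hk : IsWeakKernel k f)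
    {F G : A} {p : h.obj Y ⟶ F} (hp : Presents h f p) {q : h.obj X ⟶ G} (hq : Presents h k q) :
    ∃ (ι : G ⟶ h.obj Y) (w : ι ≫ p = 0), q ≫ ι = h.map f ∧
      (ShortComplex.mk ι p w).ShortExact := by
  obtain ⟨ι, hι⟩ := hq.desc (h.map f) (by rw [← h.map_comp, hk.zero, h.map_zero])
  have hex : RepExact h ι p :=
    { zero := hq.hom_ext (by rw [reassoc_of% hι, hp.zero, comp_zero])
      lift := fun Z x hx => by
        obtain ⟨y, hy⟩ := hp.repExact.lift x hx
        exact ⟨y ≫ q, by rw [Category.assoc, hι, hy]⟩ }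
  have hinj : RepInjective h ι := fun Z x hx => by
    obtain ⟨a, rfl⟩ := hq.surj x
    rw [Category.assoc, hι, ← h.map_comp, h.map_eq_zero_iff] at hx
    obtain ⟨b, rfl⟩ := hk.lift a hx
    rw [h.map_comp, Category.assoc, hq.zero, comp_zero]
  exact ⟨ι, hex.zero, hι, { exact := hex.exact, mono_f := hinj.mono, epi_g := hp.epi }⟩

lemma Presents.shortExact_of_mono {X Y : D} {f : X ⟶ Y} [Mono f] {F : A} {p : h.obj Y ⟶ F}
    (hp : Presents h f p) : (ShortComplex.mk (h.map f) p hp.zero).ShortExact := by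
  have hinj : RepInjective h (h.map f) := fun Z x hx => by
    obtain ⟨a, rfl⟩ := h.map_surjective x
    rw [← h.map_comp, h.map_eq_zero_iff] at hx
    rw [(cancel_mono f).1 (hx.trans zero_comp.symm), h.map_zero]
  exact { exact := hp.repExact.exact, mono_f := hinj.mono, epi_g := hp.epi }

lemma isWeakKernel_of_repExact {K X Y : D} {k : K ⟶ X} {f : X ⟶ Y}
    (hkf : RepExact h (h.map k) (h.map f)) : IsWeakKernel k f where
  zero := h.map_injective (by rw [h.map_comp, hkf.zero, h.map_zero])
  lift a ha := by
    obtain ⟨y, hy⟩ := hkf.lift (h.map a) (by rw [← h.map_comp, ha, h.map_zero])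
    obtain ⟨b, rfl⟩ := h.map_surjective y
    exact ⟨b, h.map_injective (by rw [h.map_comp, hy])⟩

/-- Cover the kernel of `h.map f` by a representable. -/
lemma hasWeakKernels_of_abelian (h : D ⥤ A) [IsPresentationFunctor h] : HasWeakKernels D := fun X Y f => by
  obtain ⟨_, P, _, c, hc⟩ :=
    IsPresentationFunctor.exists_presentation (h := h) (kernel (h.map f))
  obtain ⟨k, hk⟩ := h.map_surjective (c ≫ kernel.ι _)
  refine ⟨P, k, isWeakKernel_of_repExact (h := h) ⟨?_, fun Z x hx => ?_⟩⟩
  · rw [hk, Category.assoc, kernel.condition, comp_zero]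
  · obtain ⟨y, hy⟩ := hc.surj (kernel.lift _ x hx)
    exact ⟨h.map y, by rw [hk, reassoc_of% hy, kernel.lift_ι]⟩

variable (h) in
-- A projective is a retract of a representable `h.obj Y`. Full faithfulness carries the idempotent
-- to `Y`, where it splits.
lemma exists_iso_rep_of_projective [IsIdempotentComplete D] (P : A) [Projective P] :
    ∃ X : D, Nonempty (P ≅ h.obj X) := by
  obtain ⟨_, Y, _, p, hp⟩ := IsPresentationFunctor.exists_presentation (h := h) P
  have := hp.epi
  let s := Projective.factorThru (𝟙 P) p
  have hs : s ≫ p = 𝟙 P := Projective.factorThru_comp _ _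
  obtain ⟨e, he⟩ := h.map_surjective (p ≫ s)
  obtain ⟨X, i, r, hir, hri⟩ := IsIdempotentComplete.idempotents_split Y e
    (h.map_injective (by rw [h.map_comp, he, Category.assoc, reassoc_of% hs]))
  have hri' : h.map r ≫ h.map i = p ≫ s := by rw [← h.map_comp, hri, he]
  have hir' : h.map i ≫ h.map r = 𝟙 _ := by rw [← h.map_comp, hir, h.map_id]
  exact ⟨X, ⟨{ hom := s ≫ h.map r
               inv := h.map i ≫ p
               hom_inv_id := by
                rw [Category.assoc, reassoc_of% hri', reassoc_of% hs, hs]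
               inv_hom_id := by
                rw [Category.assoc, ← reassoc_of% hri', reassoc_of% hir', hir'] }⟩⟩

/-! ### Iterated weak kernels and projective dimension -/

/-- The morphism `f` has a weak kernel, which has a weak kernel, and so on, the `n`-th of these
being a monomorphism: `f` has an `n`-kernel. -/
def HasNKernel : ℕ → ∀ {X Y : D}, (X ⟶ Y) → Prop
  | 0, _, _, f => Mono f
  | n + 1, X, _, f => ∃ (K : D) (k : K ⟶ X), IsWeakKernel k f ∧ HasNKernel n k

/-- Each weak kernel replaces the module by its syzygy; when a monomorphism is reached, the
presentation itself is a resolution of length 1. -/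
lemma HasNKernel.hasProjectiveDimensionLE {n : ℕ} {X Y : D} {f : X ⟶ Y} (hf : HasNKernel n f)
    {F : A} {p : h.obj Y ⟶ F} (hp : Presents h f p) : HasProjectiveDimensionLE F (n + 1) := by
  induction n generalizing X Y F with
  | zero =>
    have : Mono f := hf
    have := projective_rep h X
    exact (hp.shortExact_of_mono.hasProjectiveDimensionLT_X₃_iff 0 (projective_rep h Y)).2
      (projective_iff_hasProjectiveDimensionLT_one.1 this)
  | succ n ih =>
    obtain ⟨K, k, hk, hn⟩ := hf
    obtain ⟨G, q, hq⟩ := IsPresentationFunctor.exists_presented (h := h) k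
    obtain ⟨ι, w, -, hS⟩ := hp.exists_shortExact hk hq
    exact (hS.hasProjectiveDimensionLT_X₃_iff (n + 1) (projective_rep h Y)).2 (ih hn hq)

/-- Take weak kernels until the remaining syzygy has projective dimension at most 1. One more kernel
is then projective, hence representable, and gives a weak kernel that is a monomorphism. -/
lemma Presents.hasNKernel [IsIdempotentComplete D] {n : ℕ} {X Y : D} {f : X ⟶ Y} {F : A}
    {p : h.obj Y ⟶ F} (hp : Presents h f p) (hF : HasProjectiveDimensionLE F (n + 2)) :
    HasNKernel (n + 1) f := by
  obtain ⟨K, k, hk⟩ := hasWeakKernels_of_abelian h f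
  obtain ⟨G, q, hq⟩ := IsPresentationFunctor.exists_presented (h := h) k
  obtain ⟨ι, w, hι, hS⟩ := hp.exists_shortExact hk hq
  have hG := (hS.hasProjectiveDimensionLT_X₃_iff (n + 1) (projective_rep h Y)).1 hF
  induction n generalizing X Y F K G with
  | zero =>
    -- The arbitrary weak kernel `k` is discarded here: the representable isomorphic to `kernel q`
    -- gives a better one.
    have := hq.epi
    have hS' : (ShortComplex.mk (kernel.ι q) q (kernel.condition q)).ShortExact :=
      { exact := ShortComplex.exact_kernel q }
    have := projective_iff_hasProjectiveDimensionLT_one.2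
      ((hS'.hasProjectiveDimensionLT_X₃_iff 0 (projective_rep h X)).1 hG)
    obtain ⟨P, ⟨e⟩⟩ := exists_iso_rep_of_projective h (kernel q)
    obtain ⟨l, hl⟩ := h.map_surjective (e.inv ≫ kernel.ι q)
    have := hS.mono_f
    refine ⟨P, l, isWeakKernel_of_repExact (h := h) ⟨?_, fun Z x hx => ?_⟩, ?_⟩
    · rw [hl, ← hι, Category.assoc, kernel.condition_assoc, zero_comp, comp_zero]
    · rw [← hι, ← Category.assoc] at hx
      have hx' : x ≫ q = 0 := (cancel_mono ι).1 (hx.trans zero_comp.symm)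
      exact ⟨kernel.lift q x hx' ≫ e.hom, by simp [hl]⟩
    · have : Mono (h.map l) := hl ▸ inferInstance
      exact h.mono_of_mono_map this
  | succ n ih =>
    obtain ⟨K', k', hk'⟩ := hasWeakKernels_of_abelian h k
    obtain ⟨G', q', hq'⟩ := IsPresentationFunctor.exists_presented (h := h) k'
    obtain ⟨ι', w', hι', hS'⟩ := hq.exists_shortExact hk' hq'
    exact ⟨K, k, hk, ih hq hG K' k' hk' G' q' hq' ι' w' hι' hS'
      ((hS'.hasProjectiveDimensionLT_X₃_iff (n + 1) (projective_rep h X)).1 hG)⟩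

/-- The image of `h.map f` is the first syzygy of `F`, hence projective and representable. The
surjection onto it therefore splits. -/
lemma Presents.exists_retraction_comp_mono [IsIdempotentComplete D] {X Y : D} {f : X ⟶ Y} {F : A}
    {p : h.obj Y ⟶ F} (hp : Presents h f p) (hF : HasProjectiveDimensionLE F 1) :
    ∃ (P : D) (s : X ⟶ P) (t : P ⟶ X) (g : P ⟶ Y), t ≫ s = 𝟙 P ∧ s ≫ g = f ∧ Mono g := by
  obtain ⟨K, k, hk⟩ := hasWeakKernels_of_abelian h f
  obtain ⟨G, q, hq⟩ := IsPresentationFunctor.exists_presented (h := h) k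
  obtain ⟨ι, w, hι, hS⟩ := hp.exists_shortExact hk hq
  have := projective_iff_hasProjectiveDimensionLT_one.2
    ((hS.hasProjectiveDimensionLT_X₃_iff 0 (projective_rep h Y)).1 hF)
  obtain ⟨P, ⟨e⟩⟩ := exists_iso_rep_of_projective h G
  have := hq.epi
  have := hS.mono_f
  have hfac : Projective.factorThru (𝟙 G) q ≫ q = 𝟙 G := Projective.factorThru_comp _ _
  obtain ⟨s, hs⟩ := h.map_surjective (q ≫ e.hom)
  obtain ⟨t, ht⟩ := h.map_surjective (e.inv ≫ Projective.factorThru (𝟙 G) q)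
  obtain ⟨g, hg⟩ := h.map_surjective (e.inv ≫ ι)
  refine ⟨P, s, t, g, h.map_injective ?_, h.map_injective ?_, ?_⟩
  · rw [h.map_comp, hs, ht, Category.assoc, reassoc_of% hfac, e.inv_hom_id, h.map_id]
  · rw [h.map_comp, hs, hg, Category.assoc, e.hom_inv_id_assoc, hι]
  · have : Mono (h.map g) := hg ▸ inferInstance
    exact h.mono_of_mono_map this

/-! ### Ext and presentations -/

section Ext

variable [HasExt.{w} A]

open Abelian in
-- Dimension shifting along the connecting map, as the middle term has no higher Ext.
lemma subsingleton_ext_succ_iff {S : ShortComplex A} (hS : S.ShortExact) [Projective S.X₂] (M : A)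
    (i : ℕ) : Subsingleton (Ext S.X₃ M (i + 2)) ↔ Subsingleton (Ext S.X₁ M (i + 1)) := by
  constructor
  · intro _
    refine subsingleton_of_forall_eq 0 fun x => ?_
    obtain ⟨y, rfl⟩ := Ext.contravariant_sequence_exact₁ hS M x (n₁ := i + 2) (by lia)
      (Subsingleton.elim _ _)
    rw [Ext.eq_zero_of_projective y, Ext.comp_zero]
  · intro _
    refine subsingleton_of_forall_eq 0 fun x => ?_
    obtain ⟨y, rfl⟩ := Ext.contravariant_sequence_exact₃ hS M x
      (Ext.eq_zero_of_projective _) (n₀ := i + 1) (by lia)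
    rw [Subsingleton.elim y 0, Ext.comp_zero]

open Abelian in
lemma subsingleton_ext_one_iff {S : ShortComplex A} (hS : S.ShortExact) [Projective S.X₂] (M : A) :
    Subsingleton (Ext S.X₃ M 1) ↔ ∀ a : S.X₁ ⟶ M, ∃ b : S.X₂ ⟶ M, S.f ≫ b = a := by
  constructor
  · intro _ a
    obtain ⟨y, hy⟩ := Ext.contravariant_sequence_exact₁ hS M (Ext.mk₀ a) (n₁ := 1) (by lia)
      (Subsingleton.elim _ _)
    obtain ⟨b, rfl⟩ := Ext.homEquiv₀.symm.surjective y
    refine ⟨b, ?_⟩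
    rw [Ext.homEquiv₀_symm_apply, Ext.mk₀_comp_mk₀] at hy
    exact Ext.homEquiv₀.symm.injective hy
  · intro H
    refine subsingleton_of_forall_eq 0 fun x => ?_
    obtain ⟨y, rfl⟩ := Ext.contravariant_sequence_exact₃ hS M x
      (Ext.eq_zero_of_projective _) (n₀ := 0) (by lia)
    obtain ⟨a, rfl⟩ := Ext.homEquiv₀.symm.surjective y
    obtain ⟨b, rfl⟩ := H a
    rw [Ext.homEquiv₀_symm_apply, ← Ext.mk₀_comp_mk₀, hS.extClass_comp_assoc]

open Abelian in
-- Dimension shifting along the syzygy sequence, phrased through morphisms of `D`.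
lemma Presents.subsingleton_ext_succ_iff {K X Y : D} {k : K ⟶ X} {f : X ⟶ Y}
    (hk : IsWeakKernel k f) {F G : A} {p : h.obj Y ⟶ F} (hp : Presents h f p) {q : h.obj X ⟶ G}
    (hq : Presents h k q) (M : A) (i : ℕ) :
    Subsingleton (Ext F M (i + 2)) ↔ Subsingleton (Ext G M (i + 1)) := by
  obtain ⟨ι, w, hι, hS⟩ := hp.exists_shortExact hk hq
  have : Projective (ShortComplex.mk ι p w).X₂ := projective_rep h Y
  exact NAb.subsingleton_ext_succ_iff hS M i

open Abelian in
-- Morphisms from the syzygy to `h.obj W` are the `a : X ⟶ W` killed by `k`; extending one to `h.obj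
-- Y` means factoring `a` through `f`.
lemma Presents.subsingleton_ext_one_iff {K X Y : D} {k : K ⟶ X} {f : X ⟶ Y}
    (hk : IsWeakKernel k f) {F : A} {p : h.obj Y ⟶ F} (hp : Presents h f p) (W : D) :
    Subsingleton (Ext F (h.obj W) 1) ↔
      ∀ a : X ⟶ W, k ≫ a = 0 → ∃ b : Y ⟶ W, f ≫ b = a := by
  obtain ⟨G, q, hq⟩ := IsPresentationFunctor.exists_presented (h := h) k
  obtain ⟨ι, w, hι, hS⟩ := hp.exists_shortExact hk hq
  have : Projective (ShortComplex.mk ι p w).X₂ := projective_rep h Y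
  refine (NAb.subsingleton_ext_one_iff hS _).trans ⟨fun H a ha => ?_, fun H a => ?_⟩
  · obtain ⟨c, hc⟩ := hq.desc (h.map a) (by rw [← h.map_comp, ha, h.map_zero])
    obtain ⟨b, hb⟩ := H c
    obtain ⟨b, rfl⟩ := h.map_surjective b
    refine ⟨b, h.map_injective ?_⟩
    rw [h.map_comp, ← hι, Category.assoc, ← hc]
    exact congrArg _ hb
  · obtain ⟨c, hc⟩ := h.map_surjective (q ≫ a)
    obtain ⟨b, hb⟩ := H c (h.map_injective (by
      rw [h.map_comp, hc, reassoc_of% hq.zero, zero_comp, h.map_zero]))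
    refine ⟨h.map b, hq.hom_ext ?_⟩
    change q ≫ ι ≫ h.map b = _
    rw [reassoc_of% hι, ← h.map_comp, hb, hc]

open Abelian in
/-- Composing the presentation with a split monomorphism preserves the vanishing of `Ext`. -/
lemma Presents.subsingleton_ext_comp {X Y Y' : D} {f : X ⟶ Y} {s : Y ⟶ Y'} {r : Y' ⟶ Y}
    (hsr : s ≫ r = 𝟙 Y) {F F' : A} {p : h.obj Y ⟶ F} (hp : Presents h f p)
    {p' : h.obj Y' ⟶ F'} (hp' : Presents h (f ≫ s) p') (W : D) (i : ℕ)
    (hF : Subsingleton (Ext F (h.obj W) (i + 1))) :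
    Subsingleton (Ext F' (h.obj W) (i + 1)) := by
  obtain ⟨K, k, hk⟩ := hasWeakKernels_of_abelian h f
  -- As `s` is a split monomorphism, `f` and `f ≫ s` share the weak kernel `k`, and so the first
  -- syzygy.
  have hk' : IsWeakKernel k (f ≫ s) :=
    { zero := by rw [reassoc_of% hk.zero, zero_comp]
      lift := fun a ha => hk.lift a (by
        rw [← Category.comp_id f, ← hsr, ← Category.assoc, ← Category.assoc, Category.assoc a, ha,
          zero_comp]) }
  cases i with
  | zero =>
    rw [zero_add, hp'.subsingleton_ext_one_iff hk']
    rw [zero_add, hp.subsingleton_ext_one_iff hk] at hF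
    intro a ha
    obtain ⟨b, rfl⟩ := hF a ha
    exact ⟨r ≫ b, by rw [Category.assoc, reassoc_of% hsr]⟩
  | succ i =>
    obtain ⟨G, q, hq⟩ := IsPresentationFunctor.exists_presented (h := h) k
    rw [hp'.subsingleton_ext_succ_iff hk' hq]
    rwa [hp.subsingleton_ext_succ_iff hk hq] at hF

end Ext

/-- Needed because `HasNKernels` and `HasNCokernels` realise a morphism only up to isomorphism of
arrows. -/
lemma Presents.of_arrow_iso {X Y X' Y' : D} {f : X ⟶ Y} {f' : X' ⟶ Y'}
    (e : Arrow.mk f ≅ Arrow.mk f') {F : A} {p : h.obj Y ⟶ F} (hp : Presents h f p) :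
    ∃ p' : h.obj Y' ⟶ F, Presents h f' p' := by
  let eX : X ≅ X' := Arrow.leftFunc.mapIso e
  let eY : Y ≅ Y' := Arrow.rightFunc.mapIso e
  have h₁ : eX.hom ≫ f' = f ≫ eY.hom := e.hom.w
  have h₂ : eX.inv ≫ f = f' ≫ eY.inv := e.inv.w
  refine ⟨h.map eY.inv ≫ p, ⟨?_, fun a ha => ?_, fun x => ?_⟩⟩
  · rw [← h.map_comp_assoc, ← h₂, h.map_comp, Category.assoc, hp.zero, comp_zero]
  · rw [← h.map_comp_assoc] at ha
    obtain ⟨b, hb⟩ := hp.exact _ ha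
    exact ⟨b ≫ eX.hom, by rw [Category.assoc, h₁, reassoc_of% hb, eY.inv_hom_id, Category.comp_id]⟩
  · obtain ⟨a, rfl⟩ := hp.surj x
    exact ⟨a ≫ eY.hom, by rw [← h.map_comp_assoc, Category.assoc, eY.hom_inv_id, Category.comp_id]⟩

end Abelian

/-! ### Additive functors form a presentation category -/

section FunctorCategory

universe v₁ u₁ v₂ u₂

variable {E : Type u₁} [Category.{v₁} E]

/-- The sequence of functors `F ⟶ G ⟶ H ⟶ 0` is exact at each object. -/
def IsRightExactSeq {F G H : E ⥤ AddCommGrpCat.{v}} (φ : F ⟶ G) (p : G ⟶ H) : Prop :=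
  ∀ Z : E, Function.Exact (φ.app Z).hom (p.app Z).hom ∧ Function.Surjective (p.app Z).hom

lemma exists_isRightExactSeq [Preadditive E] {F G : E ⥤ AddCommGrpCat.{v}} (φ : F ⟶ G)
    [G.Additive] :
    ∃ (H : E ⥤ AddCommGrpCat.{v}) (p : G ⟶ H), H.Additive ∧ IsRightExactSeq φ p := by
  have key : IsRightExactSeq φ (cokernel.π φ) := fun Z => by
    constructor
    · have := (ShortComplex.exact_cokernel φ).map ((evaluation E AddCommGrpCat.{v}).obj Z)
      exact (ShortComplex.ab_exact_iff_function_exact _).1 this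
    · exact (AddCommGrpCat.epi_iff_surjective _).1 (inferInstanceAs (Epi ((cokernel.π φ).app Z)))
  refine ⟨cokernel φ, cokernel.π φ, ⟨fun {X Y f g} => ?_⟩, key⟩
  have : Epi ((cokernel.π φ).app X) := inferInstance
  rw [← cancel_epi ((cokernel.π φ).app X), Preadditive.comp_add, ← NatTrans.naturality,
    ← NatTrans.naturality, ← NatTrans.naturality, G.map_add, Preadditive.add_comp]

lemma IsRightExactSeq.exists_desc {F G H : E ⥤ AddCommGrpCat.{v}} {φ : F ⟶ G} {p : G ⟶ H}
    (hp : IsRightExactSeq φ p) {T : E ⥤ AddCommGrpCat.{v}} (q : G ⟶ T) (hq : φ ≫ q = 0) :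
    ∃ r : H ⟶ T, p ≫ r = q := by
  have key (Z : E) : ∃ r : H.obj Z ⟶ T.obj Z, p.app Z ≫ r = q.app Z := by
    refine ⟨AddCommGrpCat.ofHom (AddMonoidHom.liftOfSurjective (p.app Z).hom (hp Z).2
      ⟨(q.app Z).hom, fun x hx => ?_⟩), ?_⟩
    · obtain ⟨y, rfl⟩ := ((hp Z).1 x).1 hx
      exact ConcreteCategory.congr_hom (NatTrans.congr_app hq Z) y
    · ext x
      exact AddMonoidHom.liftOfRightInverse_comp_apply _ _ (Function.rightInverse_surjInv (hp Z).2) _ x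
  choose r hr using key
  refine ⟨{ app := r, naturality := fun X Y f => ?_ }, by ext Z : 2; exact hr Z⟩
  have : Epi (p.app X) := (AddCommGrpCat.epi_iff_surjective _).2 (hp X).2
  rw [← cancel_epi (p.app X), ← NatTrans.naturality_assoc, hr, reassoc_of% hr, q.naturality]

lemma IsRightExactSeq.epi {F G H : E ⥤ AddCommGrpCat.{v}} {φ : F ⟶ G} {p : G ⟶ H}
    (hp : IsRightExactSeq φ p) : Epi p := by
  have (Z : E) : Epi (p.app Z) := (AddCommGrpCat.epi_iff_surjective _).2 (hp Z).2
  exact NatTrans.epi_of_epi_app p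

lemma IsRightExactSeq.zero {F G H : E ⥤ AddCommGrpCat.{v}} {φ : F ⟶ G} {p : G ⟶ H}
    (hp : IsRightExactSeq φ p) : φ ≫ p = 0 := by
  ext Z x
  exact ((hp Z).1 _).2 ⟨x, rfl⟩

lemma map_hom_id (F : E ⥤ AddCommGrpCat.{v}) {X : E} (x : F.obj X) : (F.map (𝟙 X)).hom x = x := by
  rw [F.map_id]
  rfl

lemma map_hom_comp (F : E ⥤ AddCommGrpCat.{v}) {X Y Z : E} (a : X ⟶ Y) (b : Y ⟶ Z) (x : F.obj X) :
    (F.map (a ≫ b)).hom x = (F.map b).hom ((F.map a).hom x) := by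
  rw [F.map_comp]
  rfl

variable {D : Type u₂} [Category.{v₂} D] [Preadditive E]

lemma map_hom_zero (F : E ⥤ AddCommGrpCat.{v}) [F.Additive] {X Y : E} (x : F.obj X) :
    (F.map (0 : X ⟶ Y)).hom x = 0 := by
  rw [F.map_zero]
  rfl

lemma map_hom_add (F : E ⥤ AddCommGrpCat.{v}) [F.Additive] {X Y : E} (a b : X ⟶ Y) (x : F.obj X) :
    (F.map (a + b)).hom x = (F.map a).hom x + (F.map b).hom x := by
  rw [F.map_add]
  rfl

/-- A universal element for each functor `y.obj Z`, representing evaluation of additive functors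
at the object `e Z`. -/
structure UniversalElements (y : D ⥤ E ⥤ AddCommGrpCat.{v}) (e : D → E) where
  elt (Z : D) : (y.obj Z).obj (e Z)
  additive (Z : D) : (y.obj Z).Additive
  surjective : Function.Surjective e
  ext {Z : D} {F : E ⥤ AddCommGrpCat.{v}} {η η' : y.obj Z ⟶ F} :
    (η.app (e Z)).hom (elt Z) = (η'.app (e Z)).hom (elt Z) → η = η'
  exists_app {Z : D} (F : E ⥤ AddCommGrpCat.{v}) [F.Additive] (x : F.obj (e Z)) :
    ∃ η : y.obj Z ⟶ F, (η.app (e Z)).hom (elt Z) = x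

variable {y : D ⥤ E ⥤ AddCommGrpCat.{v}} {e : D → E} {P : ObjectProperty (E ⥤ AddCommGrpCat.{v})}

/-- By the Yoneda lemma, elements of an additive functor at `e Z` are morphisms from `y.obj Z`.
Since `e` is surjective, testing against representables is the same as testing at every object. -/
lemma UniversalElements.presents_iff (U : UniversalElements y e) [y.Full] [y.Faithful]
    (hy : ∀ Z, P (y.obj Z)) (hP : ∀ F, P F → F.Additive) {X Y : D} (f : X ⟶ Y) {F : P.FullSubcategory}
    (p : (P.lift y hy).obj Y ⟶ F) :
    Presents (P.lift y hy) f p ↔ IsRightExactSeq (y.map f) p.hom := by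
  have hF : F.obj.Additive := hP _ F.property
  have hX := U.additive X
  have hY := U.additive Y
  constructor
  · intro hp Z
    obtain ⟨Z, rfl⟩ := U.surjective Z
    have h0 : y.map f ≫ p.hom = 0 := congrArg (fun t => t.hom) hp.zero
    refine ⟨fun x => ⟨fun hx => ?_, ?_⟩, fun x => ?_⟩
    · obtain ⟨η, rfl⟩ := U.exists_app _ x
      obtain ⟨a, rfl⟩ := y.map_surjective η
      obtain ⟨b, rfl⟩ := hp.exact a (ObjectProperty.hom_ext _ (U.ext hx))
      exact ⟨((y.map b).app _).hom (U.elt Z), by rw [y.map_comp]; rfl⟩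
    · rintro ⟨z, rfl⟩
      exact ConcreteCategory.congr_hom (NatTrans.congr_app h0 _) z
    · obtain ⟨η, rfl⟩ := U.exists_app _ x
      obtain ⟨a, ha⟩ := hp.surj (ObjectProperty.homMk η : (P.lift y hy).obj Z ⟶ F)
      refine ⟨((y.map a).app _).hom (U.elt Z), ?_⟩
      have : y.map a ≫ p.hom = η := congrArg (fun t => t.hom) ha
      rw [← this]
      rfl
  · intro hp
    refine ⟨ObjectProperty.hom_ext _ hp.zero, fun {Z} a ha => ?_, fun {Z} x => ?_⟩
    · have ha' : y.map a ≫ p.hom = 0 := congrArg (fun t => t.hom) ha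
      obtain ⟨z, hz⟩ := ((hp (e Z)).1 (((y.map a).app _).hom (U.elt Z))).1
        (ConcreteCategory.congr_hom (NatTrans.congr_app ha' _) (U.elt Z))
      obtain ⟨η, rfl⟩ := U.exists_app _ z
      obtain ⟨b, rfl⟩ := y.map_surjective η
      refine ⟨b, y.map_injective (U.ext ?_)⟩
      rw [← hz, y.map_comp]
      rfl
    · obtain ⟨z, hz⟩ := (hp (e Z)).2 ((x.hom.app _).hom (U.elt Z))
      obtain ⟨η, rfl⟩ := U.exists_app _ z
      obtain ⟨a, rfl⟩ := y.map_surjective η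
      exact ⟨a, ObjectProperty.hom_ext _ (U.ext hz)⟩

lemma UniversalElements.isPresentationFunctor [Preadditive D] (U : UniversalElements y e) [y.Full]
    [y.Faithful] [y.Additive] (hy : ∀ Z, P (y.obj Z))
    (hP : ∀ F, P F ↔ F.Additive ∧
      ∃ (X Y : D) (f : X ⟶ Y) (p : y.obj Y ⟶ F), IsRightExactSeq (y.map f) p) :
    IsPresentationFunctor (P.lift y hy) where
  full := inferInstance
  faithful := inferInstance
  additive := ⟨fun {X Y f g} => ObjectProperty.hom_ext _ y.map_add⟩
  exists_presentation F := by
    obtain ⟨-, X, Y, f, p, hp⟩ := (hP _).1 F.property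
    exact ⟨X, Y, f, ObjectProperty.homMk p,
      (U.presents_iff hy (fun F hF => ((hP F).1 hF).1) f _).2 hp⟩
  exists_presented {X Y} f := by
    have := U.additive Y
    obtain ⟨F, p, hF, hp⟩ := exists_isRightExactSeq (y.map f)
    let F' : P.FullSubcategory := ⟨F, (hP F).2 ⟨hF, X, Y, f, p, hp⟩⟩
    exact ⟨F', ObjectProperty.homMk p, (U.presents_iff hy (fun F hF => ((hP F).1 hF).1) f _).2 hp⟩
  epi {X Y f F p} hp := by
    have := ((U.presents_iff hy (fun F hF => ((hP F).1 hF).1) f _).1 hp).epi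
    exact P.ι.epi_of_epi_map this
  desc {X Y f F p} hp {G} q hq := by
    obtain ⟨r, hr⟩ := ((U.presents_iff hy (fun F hF => ((hP F).1 hF).1) f _).1 hp).exists_desc
      q.hom (congrArg (fun t => t.hom) hq)
    exact ⟨ObjectProperty.homMk r, ObjectProperty.hom_ext _ hr⟩

end FunctorCategory

/-! ### Right and left modules over `C` -/

section Modules

variable {C : Type u} [Category.{v} C] [Preadditive C]

lemma preadditiveYoneda_app_apply {Z : C} {F : Cᵒᵖ ⥤ AddCommGrpCat.{v}}
    (η : preadditiveYoneda.obj Z ⟶ F) {W : C} (a : W ⟶ Z) :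
    (η.app (op W)).hom a = (F.map a.op).hom ((η.app (op Z)).hom (𝟙 Z)) := by
  have := ConcreteCategory.congr_hom (η.naturality a.op) (𝟙 Z : Z ⟶ Z)
  change (η.app (op W)).hom (a ≫ 𝟙 Z) = _ at this
  rwa [Category.comp_id] at this

lemma preadditiveCoyoneda_app_apply {Z : Cᵒᵖ} {F : C ⥤ AddCommGrpCat.{v}}
    (η : preadditiveCoyoneda.obj Z ⟶ F) {W : C} (a : Z.unop ⟶ W) :
    (η.app W).hom a = (F.map a).hom ((η.app Z.unop).hom (𝟙 Z.unop)) := by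
  have := ConcreteCategory.congr_hom (η.naturality a) (𝟙 Z.unop)
  change (η.app W).hom (𝟙 Z.unop ≫ a) = _ at this
  rwa [Category.id_comp] at this

variable (C) in
/-- The identities are universal elements of the representable right modules. -/
def rightUniversalElements : UniversalElements (preadditiveYoneda (C := C)) op where
  elt Z := (𝟙 Z : Z ⟶ Z)
  additive Z := inferInstance
  surjective W := ⟨W.unop, rfl⟩
  ext {Z F η η'} H := by
    ext W a
    exact (preadditiveYoneda_app_apply η a).trans
      ((congrArg _ H).trans (preadditiveYoneda_app_apply η' a).symm)
  exists_app {Z} F _ x :=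
    ⟨{ app := fun W => AddCommGrpCat.ofHom
        { toFun := fun a : W.unop ⟶ Z => (F.map a.op).hom x
          map_zero' := map_hom_zero F x
          map_add' := fun a b => map_hom_add F (Quiver.Hom.op a) (Quiver.Hom.op b) x }
       naturality := fun W W' g => by
        ext a
        exact map_hom_comp F (Quiver.Hom.op a) g x },
      map_hom_id F x⟩

variable (C) in
/-- The identities are universal elements of the representable left modules. -/
def leftUniversalElements : UniversalElements (preadditiveCoyoneda (C := C)) unop where
  elt Z := (𝟙 Z.unop : Z.unop ⟶ Z.unop)
  additive Z := inferInstance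
  surjective W := ⟨op W, rfl⟩
  ext {Z F η η'} H := by
    ext W a
    exact (preadditiveCoyoneda_app_apply η a).trans
      ((congrArg _ H).trans (preadditiveCoyoneda_app_apply η' a).symm)
  exists_app {Z} F _ x :=
    ⟨{ app := fun W => AddCommGrpCat.ofHom
        { toFun := fun a : Z.unop ⟶ W => (F.map a).hom x
          map_zero' := map_hom_zero F x
          map_add' := fun a b => map_hom_add F a b x }
       naturality := fun W W' g => by
        ext a
        exact map_hom_comp F a g x },
      map_hom_id F x⟩

variable (C) in
/-- The functor sending an object of `C` to its representable right module. -/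
abbrev rightRepFunctor : C ⥤ FpRight C := (isFpRight C).lift preadditiveYoneda isFpRight_yoneda

variable (C) in
/-- The functor sending an object of `C` to its representable left module. -/
abbrev leftRepFunctor : Cᵒᵖ ⥤ FpLeft C :=
  (isFpLeft C).lift preadditiveCoyoneda fun X => isFpLeft_coyoneda X.unop

instance : (preadditiveYoneda (C := C)).Additive where
  map_add {X Y f g} := by
    ext Z a
    exact Preadditive.comp_add _ _ _ (show Z.unop ⟶ X from a) f g

instance : (preadditiveCoyoneda (C := C)).Additive where
  map_add {X Y f g} := by
    ext Z a
    exact Preadditive.add_comp _ _ _ f.unop g.unop (show X.unop ⟶ Z from a)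

instance : IsPresentationFunctor (rightRepFunctor C) :=
  (rightUniversalElements C).isPresentationFunctor _ fun _ =>
    and_congr_right fun _ => Iff.rfl

instance : IsPresentationFunctor (leftRepFunctor C) :=
  (leftUniversalElements C).isPresentationFunctor _ fun _ =>
    and_congr_right fun _ =>
      -- A left presentation by `f` is a presentation by `f.op` over `Cᵒᵖ`, so source and target are
      -- exchanged.
      ⟨fun ⟨X, Y, f, p, hp⟩ => ⟨op Y, op X, f.op, p, hp⟩,
        fun ⟨X, Y, f, p, hp⟩ => ⟨Y.unop, X.unop, f.unop, p, hp⟩⟩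

lemma rightPresents_iff {X Y : C} (f : X ⟶ Y) (F : FpRight C) :
    RightPresents f F.obj ↔
      ∃ p : (rightRepFunctor C).obj Y ⟶ F, Presents (rightRepFunctor C) f p :=
  ⟨fun ⟨p, hp⟩ => ⟨ObjectProperty.homMk p,
      ((rightUniversalElements C).presents_iff _ (fun _ hF => hF.1) f _).2 hp⟩,
    fun ⟨p, hp⟩ => ⟨p.hom,
      ((rightUniversalElements C).presents_iff _ (fun _ hF => hF.1) f _).1 hp⟩⟩

lemma leftPresents_iff {X Y : C} (f : X ⟶ Y) (F : FpLeft C) :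
    LeftPresents f F.obj ↔
      ∃ p : (leftRepFunctor C).obj (op X) ⟶ F, Presents (leftRepFunctor C) f.op p :=
  ⟨fun ⟨p, hp⟩ => ⟨ObjectProperty.homMk p,
      ((leftUniversalElements C).presents_iff _ (fun _ hF => hF.1) f.op _).2 hp⟩,
    fun ⟨p, hp⟩ => ⟨p.hom,
      ((leftUniversalElements C).presents_iff _ (fun _ hF => hF.1) f.op _).1 hp⟩⟩

end Modules

/-! ### Weak cokernels, and iterated weak kernels as sequences -/

section Sequences

universe v₁ u₁

variable {D : Type u₁} [Category.{v₁} D] [Preadditive D]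

/-- `f` is a weak cokernel of `k`. -/
structure IsWeakCokernel {K X Y : D} (k : K ⟶ X) (f : X ⟶ Y) : Prop where
  zero : k ≫ f = 0
  desc {W : D} (a : X ⟶ W) : k ≫ a = 0 → ∃ b : Y ⟶ W, f ≫ b = a

lemma IsWeakCokernel.op {K X Y : D} {k : K ⟶ X} {f : X ⟶ Y} (hf : IsWeakCokernel k f) :
    IsWeakKernel f.op k.op where
  zero := Quiver.Hom.unop_inj hf.zero
  lift a ha := (hf.desc a.unop (Quiver.Hom.op_inj ha)).elim fun b hb =>
    ⟨b.op, Quiver.Hom.unop_inj hb⟩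

lemma IsWeakKernel.op {K X Y : D} {k : K ⟶ X} {f : X ⟶ Y} (hk : IsWeakKernel k f) :
    IsWeakCokernel f.op k.op where
  zero := Quiver.Hom.unop_inj hk.zero
  desc a ha := (hk.lift a.unop (Quiver.Hom.op_inj ha)).elim fun b hb =>
    ⟨b.op, Quiver.Hom.unop_inj hb⟩

lemma IsWeakKernel.unop {K X Y : D} {k : K ⟶ X} {f : X ⟶ Y} (hf : IsWeakKernel f.op k.op) :
    IsWeakCokernel k f where
  zero := Quiver.Hom.op_inj hf.zero
  desc a ha := (hf.lift a.op (Quiver.Hom.unop_inj ha)).elim fun b hb =>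
    ⟨b.unop, Quiver.Hom.op_inj hb⟩

lemma IsWeakCokernel.unop {K X Y : D} {k : K ⟶ X} {f : X ⟶ Y} (hf : IsWeakCokernel f.op k.op) :
    IsWeakKernel k f where
  zero := Quiver.Hom.op_inj hf.zero
  lift a ha := (hf.desc a.op (Quiver.Hom.unop_inj ha)).elim fun b hb =>
    ⟨b.unop, Quiver.Hom.op_inj hb⟩

lemma HasNKernel.of_arrow_iso {n : ℕ} {X Y X' Y' : D} {f : X ⟶ Y} {f' : X' ⟶ Y'}
    (e : Arrow.mk f ≅ Arrow.mk f') (hf : HasNKernel n f) : HasNKernel n f' := by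
  cases n with
  | zero => exact ((MorphismProperty.monomorphisms D).arrow_mk_iso_iff e).1 hf
  | succ n =>
    let eX : X ≅ X' := Arrow.leftFunc.mapIso e
    let eY : Y ≅ Y' := Arrow.rightFunc.mapIso e
    have h₁ : eX.hom ≫ f' = f ≫ eY.hom := e.hom.w
    obtain ⟨K, k, hk, hn⟩ := hf
    refine ⟨K, k ≫ eX.hom, ⟨?_, fun a ha => ?_⟩,
      hn.of_arrow_iso (Arrow.isoMk (f := Arrow.mk k) (g := Arrow.mk (k ≫ eX.hom)) (Iso.refl _) eX (by simp))⟩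
    · rw [Category.assoc, h₁, reassoc_of% hk.zero, zero_comp]
    · have h₂ : eX.inv ≫ f = f' ≫ eY.inv := e.inv.w
      obtain ⟨b, hb⟩ := hk.lift (a ≫ eX.inv) (by
        rw [Category.assoc, h₂, reassoc_of% ha, zero_comp])
      exact ⟨b, by rw [reassoc_of% hb, eX.inv_hom_id, Category.comp_id]⟩

lemma HasNKernel.exists_sequence {n : ℕ} {X Y : D} {f : X ⟶ Y} (hf : HasNKernel n f) :
    ∃ (P : ℕ → D) (d : ∀ j, P (j + 1) ⟶ P j), Nonempty (Arrow.mk (d 0) ≅ Arrow.mk f) ∧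
      (∀ j < n, IsWeakKernel (d (j + 1)) (d j)) ∧ Mono (d n) := by
  induction n generalizing X Y with
  | zero =>
    let P : ℕ → D := fun j => Nat.casesOn j Y fun _ => X
    -- Positions count leftwards from the target of `f`; everything beyond `d n` is padding by
    -- identities.
    let d : ∀ j, P (j + 1) ⟶ P j :=
      fun j => Nat.rec (motive := fun j => P (j + 1) ⟶ P j) f (fun _ _ => 𝟙 X) j
    exact ⟨P, d, ⟨Iso.refl (Arrow.mk f)⟩, fun j hj => absurd hj (by lia), hf⟩
  | succ n ih =>
    obtain ⟨K, k, hk, hn⟩ := hf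
    obtain ⟨Q, d, ⟨e⟩, hd, hm⟩ := ih hn
    let eK : Q 1 ≅ K := Arrow.leftFunc.mapIso e
    let eX : Q 0 ≅ X := Arrow.rightFunc.mapIso e
    have h₁ : eK.hom ≫ k = d 0 ≫ eX.hom := e.hom.w
    have h₂ : eK.inv ≫ d 0 = k ≫ eX.inv := e.inv.w
    let P : ℕ → D := fun j => Nat.casesOn j Y Q
    let d' : ∀ j, P (j + 1) ⟶ P j :=
      -- The inductive sequence ends at `Q 0`, which is only isomorphic to `X`, hence the correction
      -- by `eX.hom`.
      fun j => Nat.rec (motive := fun j => P (j + 1) ⟶ P j) (eX.hom ≫ f) (fun i _ => d i) j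
    refine ⟨P, d', ⟨Arrow.isoMk (f := Arrow.mk (eX.hom ≫ f)) (g := Arrow.mk f) eX (Iso.refl Y)
      (by simp)⟩, fun j hj => ?_, hm⟩
    cases j with
    | succ j => exact hd j (by lia)
    | zero =>
      change IsWeakKernel (d 0) (eX.hom ≫ f)
      refine ⟨?_, fun a ha => ?_⟩
      · rw [← reassoc_of% h₁, hk.zero, comp_zero]
      · obtain ⟨b, hb⟩ := hk.lift (a ≫ eX.hom) (by rw [Category.assoc, ha])
        exact ⟨b ≫ eK.inv, by rw [Category.assoc, h₂, reassoc_of% hb, eX.hom_inv_id,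
          Category.comp_id]⟩

/-- Successor relations are hypotheses rather than part of the indices, so that the result applies
at indices such as `n + 1 - i`, which are not syntactically successors. -/
lemma HasNKernel.exists_functor {n : ℕ} {X Y : D} {f : X ⟶ Y} (hf : HasNKernel n f) :
    ∃ G : ℕᵒᵖ ⥤ D,
      (∀ a b (u : a ⟶ b), b = a + 1 → a = 0 → Nonempty (Arrow.mk (G.map u.op) ≅ Arrow.mk f)) ∧
      (∀ a b c (u : a ⟶ b) (w : b ⟶ c), b = a + 1 → c = b + 1 → a < n →
        IsWeakKernel (G.map w.op) (G.map u.op)) ∧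
      (∀ a b (u : a ⟶ b), b = a + 1 → a = n → Mono (G.map u.op)) := by
  obtain ⟨P, d, he, hd, hm⟩ := hf.exists_sequence
  have key (a : ℕ) (u : a ⟶ a + 1) : (Functor.ofOpSequence d).map u.op = d a := by
    rw [Subsingleton.elim u (homOfLE (Nat.le_add_right a 1))]
    exact Functor.ofOpSequence_map_homOfLE_succ d a
  refine ⟨Functor.ofOpSequence d, ?_, ?_, ?_⟩
  · rintro a b u rfl rfl
    rw [key]
    exact he
  · rintro a b c u w rfl rfl ha
    rw [key, key]
    exact hd a ha
  · rintro a b u rfl rfl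
    rw [key]
    exact hm

end Sequences

/-! ### `n`-kernels and `n`-cokernels as iterated weak kernels -/

section NKernels

variable {C : Type u} [Category.{v} C] [Preadditive C]

lemma initIsNKernelOfLast_iff {n : ℕ} (Z : ComposableArrows C (n + 1)) :
    InitIsNKernelOfLast Z ↔ Mono (Z.map' 0 1) ∧
      ∀ (i : ℕ) (_ : i < n), IsWeakKernel (Z.map' i (i + 1)) (Z.map' (i + 1) (i + 2)) := by
  constructor
  · intro hZ
    refine ⟨⟨fun a b hab => hZ.injective _ hab⟩, fun i hi => ⟨?_, fun {W} a ha => ?_⟩⟩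
    · have := (hZ.exact i hi _ (Z.map' i (i + 1))).2 ⟨𝟙 _, Category.id_comp _⟩
      exact this
    · exact (hZ.exact i hi W a).1 ha
  · rintro ⟨h₁, h₂⟩
    refine ⟨fun W a b hab => (cancel_mono _).1 hab, fun i hi W a =>
      ⟨fun ha => (h₂ i hi).lift a ha, ?_⟩⟩
    rintro ⟨b, rfl⟩
    change (b ≫ _) ≫ _ = 0
    rw [Category.assoc, (h₂ i hi).zero, comp_zero]

lemma tailIsNCokernelOfFirst_iff {n : ℕ} (Z : ComposableArrows C (n + 1)) :
    TailIsNCokernelOfFirst Z ↔ Epi (Z.map' n (n + 1)) ∧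
      ∀ (i : ℕ) (_ : i < n), IsWeakCokernel (Z.map' i (i + 1)) (Z.map' (i + 1) (i + 2)) := by
  constructor
  · intro hZ
    refine ⟨⟨fun a b hab => hZ.injective _ hab⟩, fun i hi => ⟨?_, fun {W} a ha => ?_⟩⟩
    · have := (hZ.exact i hi _ (Z.map' (i + 1) (i + 2))).2 ⟨𝟙 _, Category.comp_id _⟩
      exact this
    · exact (hZ.exact i hi W a).1 ha
  · rintro ⟨h₁, h₂⟩
    refine ⟨fun W a b hab => (cancel_epi _).1 hab, fun i hi W a =>
      ⟨fun ha => (h₂ i hi).desc a ha, ?_⟩⟩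
    rintro ⟨b, rfl⟩
    change _ ≫ (_ ≫ b) = 0
    rw [← Category.assoc, (h₂ i hi).zero, zero_comp]

lemma InitIsNKernelOfLast.hasNKernel {n : ℕ} {Z : ComposableArrows C (n + 1)}
    (hZ : InitIsNKernelOfLast Z) (m : ℕ) (hm : m ≤ n) : HasNKernel m (Z.map' m (m + 1)) := by
  rw [initIsNKernelOfLast_iff] at hZ
  induction m with
  | zero => exact hZ.1
  | succ m ih => exact ⟨_, _, hZ.2 m (by lia), ih (by lia)⟩

lemma TailIsNCokernelOfFirst.hasNKernel {n : ℕ} {Z : ComposableArrows C (n + 1)}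
    (hZ : TailIsNCokernelOfFirst Z) (m i : ℕ) (hm : i + m = n) :
    HasNKernel m (Z.map' i (i + 1)).op := by
  rw [tailIsNCokernelOfFirst_iff] at hZ
  induction m generalizing i with
  | zero =>
    obtain rfl : i = n := hm
    have := hZ.1
    exact inferInstanceAs (Mono (Z.map' i (i + 1)).op)
  | succ m ih => exact ⟨_, _, (hZ.2 i (by lia)).op, ih (i + 1) (by lia)⟩

/-- The iso of opposite arrows. -/
def arrowOpIso {X Y X' Y' : C} {f : X ⟶ Y} {f' : X' ⟶ Y'} (e : Arrow.mk f ≅ Arrow.mk f') :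
    Arrow.mk f.op ≅ Arrow.mk f'.op :=
  Arrow.isoMk (Arrow.rightFunc.mapIso e).op.symm (Arrow.leftFunc.mapIso e).op.symm
    (Quiver.Hom.unop_inj e.inv.w.symm)

/-- The iso of arrows given by an iso of opposite arrows. -/
def arrowUnopIso {X Y X' Y' : C} {f : X ⟶ Y} {f' : X' ⟶ Y'} (e : Arrow.mk f.op ≅ Arrow.mk f'.op) :
    Arrow.mk f ≅ Arrow.mk f' :=
  Arrow.isoMk (Arrow.rightFunc.mapIso e).unop.symm (Arrow.leftFunc.mapIso e).unop.symm
    (Quiver.Hom.op_inj e.inv.w.symm)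

lemma hasNKernels_iff (n : ℕ) :
    HasNKernels C n ↔ ∀ ⦃X Y : C⦄ (f : X ⟶ Y), HasNKernel n f := by
  refine ⟨fun H X Y f => ?_, fun H X Y f => ?_⟩
  · obtain ⟨Z, ⟨e⟩, hZ⟩ := H f
    exact (hZ.hasNKernel n le_rfl).of_arrow_iso e
  · obtain ⟨G, h₁, h₂, h₃⟩ := (H f).exists_functor
    -- The sequence is numbered from its target, so indices are reversed.
    let R : Fin (n + 1 + 1) ⥤ ℕᵒᵖ :=
      { obj := fun i => op (n + 1 - i)
        map := fun {i j} u => (homOfLE (Nat.sub_le_sub_left (leOfHom u) (n + 1))).op }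
    exact ⟨R ⋙ G, h₁ (n + 1 - (n + 1)) (n + 1 - n) (homOfLE (by lia)) (by lia) (by lia),
      (initIsNKernelOfLast_iff _).2
        ⟨h₃ (n + 1 - 1) (n + 1 - 0) (homOfLE (by lia)) (by lia) (by lia), fun i hi =>
          h₂ (n + 1 - (i + 2)) (n + 1 - (i + 1)) (n + 1 - i) (homOfLE (by lia))
            (homOfLE (by lia)) (by lia) (by lia) (by lia)⟩⟩

lemma hasNCokernels_iff (n : ℕ) :
    HasNCokernels C n ↔ ∀ ⦃X Y : C⦄ (f : X ⟶ Y), HasNKernel n f.op := by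
  refine ⟨fun H X Y f => ?_, fun H X Y f => ?_⟩
  · obtain ⟨Z, ⟨e⟩, hZ⟩ := H f
    exact (hZ.hasNKernel n 0 (by lia)).of_arrow_iso (arrowOpIso e)
  · obtain ⟨G, h₁, h₂, h₃⟩ := (H f).exists_functor
    -- Passing to `G.unop` already reverses the arrows, so no renumbering occurs.
    let R : Fin (n + 1 + 1) ⥤ ℕ :=
      { obj := fun i => i
        map := fun {i j} u => homOfLE (leOfHom u) }
    refine ⟨R ⋙ G.unop, (h₁ 0 1 (homOfLE _) rfl rfl).map arrowUnopIso,
      (tailIsNCokernelOfFirst_iff _).2 ⟨?_, fun i hi =>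
        (h₂ i (i + 1) (i + 2) (homOfLE _) (homOfLE _) rfl rfl hi).unop⟩⟩
    have := h₃ n (n + 1) (homOfLE (by lia)) rfl rfl
    exact inferInstanceAs (Epi (G.map (homOfLE (by lia : n ≤ n + 1)).op).unop)

end NKernels

/-! ### Ext vanishing as exactness on the opposite side -/

section Duality

universe w v₁ u₁ v₂ u₂

/-- This turns an Ext condition over one side into weak exactness over the other. -/
lemma Presents.forall_subsingleton_ext_one_iff {D : Type u₁} [Category.{v₁} D] [Preadditive D]
    [HasBinaryBiproducts D] {A : Type u₂} [Category.{v₂} A] [Abelian A] [HasExt.{w} A] {h : D ⥤ A}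
    [IsPresentationFunctor h] {K X Y : D} {k : K ⟶ X} {f : X ⟶ Y} (hk : IsWeakKernel k f) {F : A}
    {p : h.obj Y ⟶ F} (hp : Presents h f p) :
    (∀ W, Subsingleton (Abelian.Ext F (h.obj W) 1)) ↔ IsWeakCokernel k f := by
  simp only [hp.subsingleton_ext_one_iff hk]
  exact ⟨fun H => ⟨hk.zero, fun a ha => H _ a ha⟩, fun H W a ha => H.desc a ha⟩

variable {C : Type u} [Category.{v} C] [Preadditive C] [HasBinaryBiproducts C] {n : ℕ}
  {Z : ComposableArrows C (n + 1)}

/-- The next arrow of the tail presents the syzygy of `T`, so `k` dimension shifts move from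
position `i` to `j = i + k`, where the Ext group in degree 1 is read off. -/
lemma TailIsNCokernelOfFirst.subsingleton_ext_iff [IsLeftCoherent C] [HasExt.{w} (FpLeft C)]
    (hZ : TailIsNCokernelOfFirst Z) (k i j : ℕ) (hij : i + k = j) (hj : j < n) {T : FpLeft C}
    {p : (leftRepFunctor C).obj _ ⟶ T}
    (hp : Presents (leftRepFunctor C) (Z.map' i (i + 1)).op p) :
    (∀ W, Subsingleton (Abelian.Ext T ((leftRepFunctor C).obj W) (k + 1))) ↔
      IsWeakKernel (Z.map' j (j + 1)) (Z.map' (j + 1) (j + 2)) := by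
  have hw := ((tailIsNCokernelOfFirst_iff Z).1 hZ).2
  induction k generalizing i T with
  | zero =>
    obtain rfl : i = j := hij
    rw [zero_add, hp.forall_subsingleton_ext_one_iff (hw i hj).op]
    exact ⟨fun H => H.unop, fun H => H.op⟩
  | succ k ih =>
    obtain ⟨T', p', hp'⟩ := IsPresentationFunctor.exists_presented (h := leftRepFunctor C)
      (Z.map' (i + 1) (i + 2)).op
    exact (forall_congr' fun W =>
      hp.subsingleton_ext_succ_iff (hw i (by lia)).op hp' _ k).trans (ih (i + 1) (by lia) hp')

/-- The same shift, with syzygies moving to the left: `k` steps lead from `i` down to `j = i - k`.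
-/
lemma InitIsNKernelOfLast.subsingleton_ext_iff [IsRightCoherent C] [HasExt.{w} (FpRight C)]
    (hZ : InitIsNKernelOfLast Z) (k i j : ℕ) (hij : j + k = i) (hi : i < n) {T : FpRight C}
    {p : (rightRepFunctor C).obj _ ⟶ T}
    (hp : Presents (rightRepFunctor C) (Z.map' (i + 1) (i + 2)) p) :
    (∀ W, Subsingleton (Abelian.Ext T ((rightRepFunctor C).obj W) (k + 1))) ↔
      IsWeakCokernel (Z.map' j (j + 1)) (Z.map' (j + 1) (j + 2)) := by
  have hw := ((initIsNKernelOfLast_iff Z).1 hZ).2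
  induction k generalizing i T with
  | zero =>
    obtain rfl : j = i := hij
    rw [zero_add, hp.forall_subsingleton_ext_one_iff (hw j hi)]
  | succ k ih =>
    obtain ⟨i, rfl⟩ : ∃ i', i = i' + 1 := ⟨i - 1, by lia⟩
    obtain ⟨T', p', hp'⟩ := IsPresentationFunctor.exists_presented (h := rightRepFunctor C)
      (Z.map' (i + 1) (i + 2))
    exact (forall_congr' fun W =>
      hp.subsingleton_ext_succ_iff (hw (i + 1) hi) hp' _ k).trans (ih i (by lia) (by lia) hp')

end Duality

/-! ### The axioms and their equivalence -/

section Main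

variable {C : Type u} [Category.{v} C] [Preadditive C] [HasBinaryBiproducts C] {n : ℕ}

lemma globalDimension_le_iff {A : Type u} [Category.{v} A] [Abelian A] (m : ℕ) :
    globalDimension A ≤ (m : WithBot ℕ∞) ↔ ∀ X : A, HasProjectiveDimensionLE X m := by
  simp only [globalDimension, iSup_le_iff, projectiveDimension_le_iff]

lemma hasProjectiveDimensionLE_one_iff {A : Type u} [Category.{v} A] [Abelian A] (X : A) :
    projectiveDimension X ≤ 1 ↔ HasProjectiveDimensionLE X 1 := by
  rw [← projectiveDimension_le_iff, Nat.cast_one]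

section

variable {D : Type*} [Category* D] [Preadditive D] [HasBinaryBiproducts D]

lemma hasWeakKernels_of_hasNKernel (hn : 1 ≤ n)
    (H : ∀ ⦃X Y : D⦄ (f : X ⟶ Y), HasNKernel n f) : HasWeakKernels D := fun X Y f => by
  obtain ⟨m, rfl⟩ : ∃ m, n = m + 1 := ⟨n - 1, by lia⟩
  obtain ⟨K, k, hk, -⟩ := H f
  exact ⟨K, k, hk⟩

lemma forall_hasProjectiveDimensionLE_iff [IsIdempotentComplete D] {A : Type*} [Category* A]
    [Abelian A] (h : D ⥤ A) [IsPresentationFunctor h] (hn : 1 ≤ n) :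
    (∀ X : A, HasProjectiveDimensionLE X (n + 1)) ↔
      ∀ ⦃X Y : D⦄ (f : X ⟶ Y), HasNKernel n f := by
  refine ⟨fun H X Y f => ?_, fun H F => ?_⟩
  · obtain ⟨m, rfl⟩ : ∃ m, n = m + 1 := ⟨n - 1, by lia⟩
    obtain ⟨F, p, hp⟩ := IsPresentationFunctor.exists_presented (h := h) f
    exact hp.hasNKernel (H F)
  · obtain ⟨X, Y, f, p, hp⟩ := IsPresentationFunctor.exists_presentation (h := h) F
    exact (H f).hasProjectiveDimensionLE hp

end

variable [IsIdempotentComplete C]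

/-- Reduce the given presentation to its monic part `g`, whose `n`-cokernel is exact on both sides
by the monomorphism axiom. Then return from `g` to `s ≫ g`. -/
lemma IsNAbelian.isRightTorsionFree [IsRightCoherent C] [IsLeftCoherent C] (hC : IsNAbelian C n)
    (F : FpRight C) (hF : HasProjectiveDimensionLE F 1) : IsRightTorsionFree n F := by
  let := HasExt.standard (FpLeft C)
  rintro T ⟨X, Y, f, hFf, hTf⟩ i hi hin W
  obtain ⟨p, hp⟩ := (rightPresents_iff f F).1 hFf
  obtain ⟨q, hq⟩ := (leftPresents_iff f T).1 hTf
  obtain ⟨P, s, t, g, hts, rfl, hg⟩ := hp.exists_retraction_comp_mono hF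
  obtain ⟨Z, ⟨e⟩, hZ⟩ := hC.hasNCokernels g
  have hZ' := hC.mono Z (((MorphismProperty.monomorphisms C).arrow_mk_iso_iff e).2 hg) hZ
  obtain ⟨T', q', hq'⟩ := IsPresentationFunctor.exists_presented (h := leftRepFunctor C)
    (Z.map' 0 1).op
  obtain ⟨k, rfl⟩ : ∃ k, i = k + 1 := ⟨i - 1, by lia⟩
  have hE := (hZ.subsingleton_ext_iff k 0 k (by lia) (by lia) hq').2
    (((initIsNKernelOfLast_iff Z).1 hZ').2 k (by lia)) (op W)
  obtain ⟨q'', hq''⟩ := hq'.of_arrow_iso (arrowOpIso e)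
  -- In `Cᵒᵖ` the split epimorphism `s` becomes a split monomorphism after `g.op`.
  exact hq''.subsingleton_ext_comp (s := s.op) (r := t.op) (Quiver.Hom.unop_inj hts) hq (op W) k hE

lemma IsNAbelian.isLeftTorsionFree [IsRightCoherent C] [IsLeftCoherent C] (hC : IsNAbelian C n)
    (F : FpLeft C) (hF : HasProjectiveDimensionLE F 1) : IsLeftTorsionFree n F := by
  let := HasExt.standard (FpRight C)
  rintro T ⟨X, Y, f, hTf, hFf⟩ i hi hin W
  obtain ⟨p, hp⟩ := (leftPresents_iff f F).1 hFf
  obtain ⟨q, hq⟩ := (rightPresents_iff f T).1 hTf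
  obtain ⟨P, s, t, g, hts, hsg, hg⟩ := hp.exists_retraction_comp_mono hF
  obtain rfl : f = g.unop ≫ s.unop := Quiver.Hom.op_inj hsg.symm
  obtain ⟨Z, ⟨e⟩, hZ⟩ := hC.hasNKernels g.unop
  have hZ' := hC.epi Z (((MorphismProperty.epimorphisms C).arrow_mk_iso_iff e).2
    (inferInstanceAs (Epi g.unop))) hZ
  obtain ⟨m, rfl⟩ : ∃ m, n = m + 1 := ⟨n - 1, by lia⟩
  obtain ⟨T', q', hq'⟩ := IsPresentationFunctor.exists_presented (h := rightRepFunctor C)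
    (Z.map' (m + 1) (m + 2))
  obtain ⟨k, rfl⟩ : ∃ k, i = k + 1 := ⟨i - 1, by lia⟩
  have hE := (hZ.subsingleton_ext_iff k m (m - k) (by lia) (by lia) hq').2
    (((tailIsNCokernelOfFirst_iff Z).1 hZ').2 (m - k) (by lia)) W
  obtain ⟨q'', hq''⟩ := hq'.of_arrow_iso e
  exact hq''.subsingleton_ext_comp (s := s.unop) (r := t.unop) (Quiver.Hom.op_inj hts) hq W k hE

/-- The cokernel of a representable monomorphism has projective dimension at most 1. Its torsion
freeness in degree `i + 1` is exactness at position `i`. -/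
lemma initIsNKernelOfLast_of_torsionFree [IsRightCoherent C] [IsLeftCoherent C]
    (H : ∀ F : FpRight C, HasProjectiveDimensionLE F 1 → IsRightTorsionFree n F)
    (Z : ComposableArrows C (n + 1)) (hZ : Mono (Z.map' 0 1)) (h : TailIsNCokernelOfFirst Z) :
    InitIsNKernelOfLast Z := by
  let := HasExt.standard (FpLeft C)
  obtain ⟨F, p, hp⟩ := IsPresentationFunctor.exists_presented (h := rightRepFunctor C) (Z.map' 0 1)
  obtain ⟨T, q, hq⟩ := IsPresentationFunctor.exists_presented (h := leftRepFunctor C)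
    (Z.map' 0 1).op
  have hF := H F (HasNKernel.hasProjectiveDimensionLE (n := 0) hZ hp) T
    ⟨_, _, Z.map' 0 1, (rightPresents_iff _ F).2 ⟨p, hp⟩, (leftPresents_iff _ T).2 ⟨q, hq⟩⟩
  exact (initIsNKernelOfLast_iff Z).2 ⟨hZ, fun i hi =>
    (h.subsingleton_ext_iff i 0 i (by lia) hi hq).1 fun W => hF (i + 1) (by lia) (by lia) W.unop⟩

lemma tailIsNCokernelOfFirst_of_torsionFree [IsRightCoherent C] [IsLeftCoherent C]
    (H : ∀ F : FpLeft C, HasProjectiveDimensionLE F 1 → IsLeftTorsionFree n F)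
    (Z : ComposableArrows C (n + 1)) (hZ : Epi (Z.map' n (n + 1))) (h : InitIsNKernelOfLast Z) :
    TailIsNCokernelOfFirst Z := by
  let := HasExt.standard (FpRight C)
  obtain ⟨F, p, hp⟩ := IsPresentationFunctor.exists_presented (h := leftRepFunctor C)
    (Z.map' n (n + 1)).op
  obtain ⟨T, q, hq⟩ := IsPresentationFunctor.exists_presented (h := rightRepFunctor C)
    (Z.map' n (n + 1))
  have hF := H F (HasNKernel.hasProjectiveDimensionLE (n := 0)
      (inferInstanceAs (Mono (Z.map' n (n + 1)).op)) hp) T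
    ⟨_, _, Z.map' n (n + 1), (rightPresents_iff _ T).2 ⟨q, hq⟩, (leftPresents_iff _ F).2 ⟨p, hp⟩⟩
  refine (tailIsNCokernelOfFirst_iff Z).2 ⟨hZ, fun i hi => ?_⟩
  obtain ⟨m, rfl⟩ : ∃ m, n = m + 1 := ⟨n - 1, by lia⟩
  -- The transpose is presented by the last arrow, so position `i` is reached after `m - i` shifts,
  -- that is in degree `m - i + 1 = n - i`.
  exact (h.subsingleton_ext_iff (m - i) m i (by lia) (by lia) hq).1 fun W =>
    hF (m - i + 1) (by lia) (by lia) W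

end Main

end NAb

theorem theorem2 {C : Type u} [Category.{v} C] [Preadditive C] [HasZeroObject C]
    [HasFiniteBiproducts C] [IsIdempotentComplete C] (n : ℕ) (hn : 1 ≤ n) :
    NAb.IsNAbelian C n ↔
      ∃ (_ : NAb.IsRightCoherent C) (_ : NAb.IsLeftCoherent C),
        NAb.globalDimension (NAb.FpRight C) ≤ ((n + 1 : ℕ) : WithBot ℕ∞) ∧
        NAb.globalDimension (NAb.FpLeft C) ≤ ((n + 1 : ℕ) : WithBot ℕ∞) ∧
        (∀ F : NAb.FpRight C, projectiveDimension F ≤ 1 → NAb.IsRightTorsionFree n F) ∧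
        (∀ F : NAb.FpLeft C, projectiveDimension F ≤ 1 → NAb.IsLeftTorsionFree n F) := by
  have := hasBinaryBiproducts_of_finite_biproducts C
  have hop : NAb.HasNCokernels C n ↔ ∀ ⦃X Y : Cᵒᵖ⦄ (f : X ⟶ Y), NAb.HasNKernel n f :=
    (NAb.hasNCokernels_iff n).trans ⟨fun H X Y f => H f.unop, fun H X Y f => H f.op⟩
  constructor
  · intro hC
    have hK := (NAb.hasNKernels_iff n).1 hC.hasNKernels
    have hK' := hop.1 hC.hasNCokernels
    have hR : NAb.IsRightCoherent C := NAb.isAbelianCategory_of_rep (NAb.rightRepFunctor C)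
      (NAb.hasWeakKernels_of_hasNKernel hn hK)
    have hL : NAb.IsLeftCoherent C := NAb.isAbelianCategory_of_rep (NAb.leftRepFunctor C)
      (NAb.hasWeakKernels_of_hasNKernel hn hK')
    refine ⟨hR, hL, ?_, ?_, fun F hF => ?_, fun F hF => ?_⟩
    · exact (NAb.globalDimension_le_iff _).2
        ((NAb.forall_hasProjectiveDimensionLE_iff (NAb.rightRepFunctor C) hn).2 hK)
    · exact (NAb.globalDimension_le_iff _).2
        ((NAb.forall_hasProjectiveDimensionLE_iff (NAb.leftRepFunctor C) hn).2 hK')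
    · exact hC.isRightTorsionFree F ((NAb.hasProjectiveDimensionLE_one_iff F).1 hF)
    · exact hC.isLeftTorsionFree F ((NAb.hasProjectiveDimensionLE_one_iff F).1 hF)
  · rintro ⟨hR, hL, h₁, h₁', h₂, h₂'⟩
    rw [NAb.globalDimension_le_iff] at h₁ h₁'
    simp only [NAb.hasProjectiveDimensionLE_one_iff] at h₂ h₂'
    exact
      { hasNKernels := (NAb.hasNKernels_iff n).2
          ((NAb.forall_hasProjectiveDimensionLE_iff (NAb.rightRepFunctor C) hn).1 h₁)
        hasNCokernels := hop.2
          ((NAb.forall_hasProjectiveDimensionLE_iff (NAb.leftRepFunctor C) hn).1 h₁')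
        mono := NAb.initIsNKernelOfLast_of_torsionFree h₂
        epi := NAb.tailIsNCokernelOfFirst_of_torsionFree h₂' }
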